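/- Model I. A set of $n$ items is split into two unknown clusters $R,B$ (one of which may be empty). Querying a pair of distinct items reports whether the two items lie in the same cluster; each reported answer is wrong, independently, with probability $q=\frac12-c$, where $0<c<\frac12$ is called the gap. Theorem. For $n\ge 3$ put $Q(n,c)=n\log n\,(2c)^{-\frac{\log n}{\log\log n}}$ (natural logarithms). There are an absolute constant $C>0$ and a deterministic algorithm with running time polynomial in $n$ such that the following holds. Let $m=\lceil C\,Q(n,c)\rceil$, so that $m=\Theta(Q(n,c))$ with absolute constants. Query a uniformly random set of $m$ distinct pairs, and give the algorithm $n$, the queried pairs and the answers (but not $c$). If the gap $c$ (which may depend on $n$) is such that $m\le\binom n2$ for all large $n$, then for every choice of the clusters the algorithm outputs the partition $\{R,B\}$ with probability tending to $1$ as $n\to\infty$. Every constant gap $0<c<\frac12$ satisfies $m\le\binom n2$ for all large $n$, and for it the number of queries is $O\bigl(n^{1+\frac{\log(1/(2c))}{\log\log n}}\log n\bigr)$; in particular it is $O\bigl(n^{1+\frac{1}{\log\log n}}\log n\bigr)$ if $2c\ge e^{-1}$. -/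

import Mathlib

open Filter Topology Asymptotics

/-! ### A random access machine with a step count -/

/-- A configuration of the machine: registers and an unbounded memory, all holding natural
numbers. -/
structure RamState where
  reg : ℕ → ℕ
  mem : ℕ → ℕ

/-- Structured programs of a random access machine. The only arithmetic is addition and truncated
subtraction, so that unit cost is a polynomially faithful measure of time. -/
inductive RamProg where
  /-- `reg r := k` for a constant `k` -/
  | const (r k : ℕ)
  /-- `reg r := reg s + reg t` -/
  | add (r s t : ℕ)
  /-- `reg r := reg s - reg t`, truncated at `0` -/
  | sub (r s t : ℕ)
  /-- `reg r := mem (reg s)` -/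
  | load (r s : ℕ)
  /-- `mem (reg r) := reg s` -/
  | store (r s : ℕ)
  /-- sequential composition -/
  | seq (P Q : RamProg)
  /-- run `P` if `reg r ≠ 0`, and `Q` otherwise -/
  | cond (r : ℕ) (P Q : RamProg)
  /-- while `reg r ≠ 0`, run `P` -/
  | loop (r : ℕ) (P : RamProg)

/-- `RamExec P s s' t`: started in configuration `s`, the program `P` halts in configuration `s'`
after exactly `t` steps. Every elementary instruction and every test costs one step. -/
inductive RamExec : RamProg → RamState → RamState → ℕ → Prop where
  | const (s : RamState) (r k : ℕ) :
      RamExec (.const r k) s ⟨Function.update s.reg r k, s.mem⟩ 1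
  | add (s : RamState) (r a b : ℕ) :
      RamExec (.add r a b) s ⟨Function.update s.reg r (s.reg a + s.reg b), s.mem⟩ 1
  | sub (s : RamState) (r a b : ℕ) :
      RamExec (.sub r a b) s ⟨Function.update s.reg r (s.reg a - s.reg b), s.mem⟩ 1
  | load (s : RamState) (r a : ℕ) :
      RamExec (.load r a) s ⟨Function.update s.reg r (s.mem (s.reg a)), s.mem⟩ 1
  | store (s : RamState) (r a : ℕ) :
      RamExec (.store r a) s ⟨s.reg, Function.update s.mem (s.reg r) (s.reg a)⟩ 1
  | seq {P Q : RamProg} {s₁ s₂ s₃ : RamState} {t₁ t₂ : ℕ}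
      (h₁ : RamExec P s₁ s₂ t₁) (h₂ : RamExec Q s₂ s₃ t₂) :
      RamExec (.seq P Q) s₁ s₃ (t₁ + t₂)
  | cond_true {r : ℕ} {P Q : RamProg} {s s' : RamState} {t : ℕ}
      (h : s.reg r ≠ 0) (h' : RamExec P s s' t) : RamExec (.cond r P Q) s s' (t + 1)
  | cond_false {r : ℕ} {P Q : RamProg} {s s' : RamState} {t : ℕ}
      (h : s.reg r = 0) (h' : RamExec Q s s' t) : RamExec (.cond r P Q) s s' (t + 1)
  | loop_done {r : ℕ} {P : RamProg} {s : RamState} (h : s.reg r = 0) :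
      RamExec (.loop r P) s s 1
  | loop_step {r : ℕ} {P : RamProg} {s₁ s₂ s₃ : RamState} {t₁ t₂ : ℕ}
      (h : s₁.reg r ≠ 0) (h₁ : RamExec P s₁ s₂ t₁) (h₂ : RamExec (.loop r P) s₂ s₃ t₂) :
      RamExec (.loop r P) s₁ s₃ (t₁ + t₂ + 1)

/-! ### Queries and their answers -/

/-- The outcome of a set of queries on the items `Fin n`: a pair has the value `none` if it was not
queried, `some true` if the reported answer is "same cluster", and `some false` if it is
"different clusters". -/
abbrev Answers (n : ℕ) := Sym2 (Fin n) → Option Bool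

/-- The answers received if the true clustering is `f`, the set of queried pairs is `E`, and the
queries in `X` are the corrupted ones. -/
def answers {n : ℕ} (f : Fin n → Bool) (E X : Finset (Sym2 (Fin n))) : Answers n := fun e =>
  if e ∈ E then
    some (xor (decide (e ∈ X))
      (Sym2.lift ⟨fun u v => decide (f u = f v), fun u v => by simp only [eq_comm]⟩ e))
  else none

/-- Encoding of the possible entries of the input matrix. -/
def answerCode : Option Bool → ℕ
  | none => 0
  | some true => 1
  | some false => 2

/-- The initial configuration on a given input: register `0` holds `n`, memory cell `u * n + v`
holds the code of the entry `(u, v)` for all `u, v < n`, and everything else is `0`. -/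
def initState (n : ℕ) (a : Answers n) : RamState where
  reg := fun r => if r = 0 then n else 0
  mem := fun i =>
    if h : i < n * n then
      answerCode (a s(⟨i / n, Nat.div_lt_of_lt_mul h⟩,
        ⟨i % n, Nat.mod_lt i (Nat.pos_of_ne_zero fun h0 => by simp [h0] at h)⟩))
    else 0

/-- On the answers `a` the program halts, and its output is the partition into the two clusters
of `f`. The output puts `v` into one of two classes according to whether memory cell `n * n + v`
is zero in the end; which class gets which name is irrelevant. -/
def Recovers {n : ℕ} (P : RamProg) (a : Answers n) (f : Fin n → Bool) : Prop :=
  ∃ (s : RamState) (t : ℕ), RamExec P (initState n a) s t ∧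
    ∀ u v : Fin n, ((s.mem (n * n + u) = 0 ↔ s.mem (n * n + v) = 0) ↔ f u = f v)

/-! ### The random experiment -/

open Classical in
/-- The probability that `P` recovers the clustering `f` of `n` items if the set `E` of queried
pairs is uniformly distributed over all sets of `m` distinct pairs of distinct items (`m` being at
most the number of pairs) and the answer to every query is corrupted independently with
probability `q`; here `X` runs over the possible sets of corrupted queries. -/
noncomputable def recoveryProb (P : RamProg) (n m : ℕ) (q : ℝ) (f : Fin n → Bool) : ℝ :=
  ∑ E ∈ Finset.powersetCard m (⊤ : SimpleGraph (Fin n)).edgeFinset,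
    (((n.choose 2).choose m : ℕ) : ℝ)⁻¹ *
      ∑ X ∈ E.powerset, q ^ X.card * (1 - q) ^ (E \ X).card *
        (if Recovers P (answers f E X) f then 1 else 0)

/-- The function `n log n (2c)^{- log n / log log n}`. -/
noncomputable def queryScale (n : ℕ) (c : ℝ) : ℝ :=
  n * Real.log n * (2 * c) ^ (-(Real.log n / Real.log (Real.log n)))

/-- The number of queries, `C n log n (2c)^{- log n / log log n}` rounded up. -/
noncomputable def numQueries (C : ℝ) (n : ℕ) (c : ℝ) : ℕ :=
  ⌈C * queryScale n c⌉₊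

/-!
Fix the clustering and write the answer to a query as `1` (correct), `-1` (corrupted) or `0` (not
queried). With the relative signs of the items taken out, the reported answers are exactly these
numbers, so the program may be analysed as if all items were in one cluster and every score should
be positive.

The program. The items are split by their residues into a layer `0`, a large layer `1`, small
layers `2, …, k + 1`, and large layers `k + 2`, `k + 3`, `k + 4`, where `k` is the number of binary
digits of `n`. Starting from item `0`, the score of an item in round `j + 1` is the sum of the
scores of layer `j`, each multiplied by the answer for the pair (`score`). Up to round `k + 2` the
scores are kept as they are, so they count signed paths through the layers (`pathVal`); from then on
only their signs are kept, which makes the last two rounds majority votes. A score is a difference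
of two natural numbers, so additions suffice, and `reaches_cluster` bounds the time by a cubic
polynomial in `n`.

Why the path counts have the right sign. If every pair were queried independently with probability
`p`, the first two moments of the path counts would satisfy a linear recursion from layer to layer
(`totalMean_succ`, `totalMoment_succ_le`, `sumMoment_succ_le`). With `θ = p * (1 - 2 * q) ^ 2` the
signal of a large layer is `K = n * θ / 12`, and the number of queries makes `K` at least a constant
times `log n`. The large layer `1` gives concentration of the total count at the start, and each of
the `k` small layers still has signal at least `K / k ≥ 4`, so that the independent fluctuations of
the single counts shrink by a factor `4 ^ k ≥ n` (`moment_recursion`). Hence the second moment of a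
path count in layer `k + 3` is `1 + O(1 / log n)` times the square of its mean, and by Chebyshev's
inequality most of these counts are positive.

The uniform model. The set of queries is uniform of size `m`, not binomial. A path count is a
polynomial in the answers with nonnegative coefficients and small degree, and a monomial has nearly
the same average in both models, with a one-sided error. This gives an upper bound for second
moments (`unifAvg_poly_le`) and a lower bound for means (`le_unifAvg_poly`), which is what
Chebyshev's inequality needs (`unifAvg_nonpos_count_le`). For the votes a loss of a factor
`binom(n, 2) + 1` is affordable (`unifAvg_le_binAvg`), their failure being exponentially unlikely.

The votes. Given that most labels of layer `k + 3` are right, the answers between layers `k + 3` and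
`k + 4` are independent of these labels, and `binAvg_vote_le` bounds the probability that
the vote on an item of layer `k + 4` fails. Finally layer `k + 4` votes on all items. Its labels
depend on the answers, but they may be replaced by the true ones, with which they agree outside the
previous event; so no independence is needed (`recovers_of_votes`, `one_sub_recoveryProb_le`).

The number of queries enters only through `le_queryScale`: as `log n / log log n ≥ 2`, it is at
least a constant times `n * log n / (2 * c) ^ 2`, that is, `K` is at least a constant times `log n`.
-/

/-! ### Loop-free programs and bounded execution -/

namespace RamProg

/-- The program contains no loop. -/
def loopFree : RamProg → Bool
  | .const _ _ | .add _ _ _ | .sub _ _ _ | .load _ _ | .store _ _ => true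
  | .seq P Q => P.loopFree && Q.loopFree
  | .cond _ P Q => P.loopFree && Q.loopFree
  | .loop _ _ => false

/-- An upper bound for the number of steps of a loop-free program. -/
def cost : RamProg → ℕ
  | .const _ _ | .add _ _ _ | .sub _ _ _ | .load _ _ | .store _ _ => 1
  | .seq P Q => P.cost + Q.cost
  | .cond _ P Q => P.cost + Q.cost + 1
  | .loop _ _ => 0

/-- The final configuration of a loop-free program; loops are skipped. -/
def eval : RamProg → RamState → RamState
  | .const r k, s => ⟨Function.update s.reg r k, s.mem⟩
  | .add r a b, s => ⟨Function.update s.reg r (s.reg a + s.reg b), s.mem⟩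
  | .sub r a b, s => ⟨Function.update s.reg r (s.reg a - s.reg b), s.mem⟩
  | .load r a, s => ⟨Function.update s.reg r (s.mem (s.reg a)), s.mem⟩
  | .store r a, s => ⟨s.reg, Function.update s.mem (s.reg r) (s.reg a)⟩
  | .seq P Q, s => Q.eval (P.eval s)
  | .cond r P Q, s => if s.reg r ≠ 0 then P.eval s else Q.eval s
  | .loop _ _, s => s

theorem exec_eval {P : RamProg} (hP : P.loopFree = true) (s : RamState) :
    ∃ t, RamExec P s (P.eval s) t ∧ t ≤ P.cost := by
  induction P generalizing s with
  | const r k => exact ⟨1, .const .., le_rfl⟩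
  | add r a b => exact ⟨1, .add .., le_rfl⟩
  | sub r a b => exact ⟨1, .sub .., le_rfl⟩
  | load r a => exact ⟨1, .load .., le_rfl⟩
  | store r a => exact ⟨1, .store .., le_rfl⟩
  | seq P Q ihP ihQ =>
    simp only [loopFree, Bool.and_eq_true] at hP
    obtain ⟨t₁, h₁, l₁⟩ := ihP hP.1 s
    obtain ⟨t₂, h₂, l₂⟩ := ihQ hP.2 (P.eval s)
    exact ⟨_, .seq h₁ h₂, Nat.add_le_add l₁ l₂⟩
  | cond r P Q ihP ihQ =>
    simp only [loopFree, Bool.and_eq_true] at hP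
    by_cases h : s.reg r = 0
    · obtain ⟨t, h', l⟩ := ihQ hP.2 s
      refine ⟨t + 1, ?_, ?_⟩
      · simpa [eval, h] using RamExec.cond_false (P := P) h h'
      · simp only [cost]; omega
    · obtain ⟨t, h', l⟩ := ihP hP.1 s
      refine ⟨t + 1, ?_, ?_⟩
      · simpa [eval, h] using RamExec.cond_true (Q := Q) h h'
      · simp only [cost]; omega
  | loop r P ih => simp [loopFree] at hP

end RamProg

/-- Started in `s`, the program `P` halts after at most `T` steps in a configuration
satisfying `Q`. -/
def Reaches (P : RamProg) (s : RamState) (T : ℕ) (Q : RamState → Prop) : Prop :=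
  ∃ s' t, RamExec P s s' t ∧ t ≤ T ∧ Q s'

namespace Reaches

variable {P P' : RamProg} {s : RamState} {T T' : ℕ} {Q R : RamState → Prop}

theorem mono (h : Reaches P s T Q) (hT : T ≤ T') (hQ : ∀ s', Q s' → R s') : Reaches P s T' R := by
  obtain ⟨s', t, h, ht, hq⟩ := h
  exact ⟨s', t, h, ht.trans hT, hQ _ hq⟩

theorem of_loopFree (hP : P.loopFree = true) (hQ : Q (P.eval s)) : Reaches P s P.cost Q := by
  obtain ⟨t, h, ht⟩ := RamProg.exec_eval hP s
  exact ⟨_, t, h, ht, hQ⟩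

theorem seq (h : Reaches P s T Q) (h' : ∀ s', Q s' → Reaches P' s' T' R) :
    Reaches (.seq P P') s (T + T') R := by
  obtain ⟨s', t, h, ht, hq⟩ := h
  obtain ⟨s'', t', h', ht', hr⟩ := h' s' hq
  exact ⟨s'', _, .seq h h', Nat.add_le_add ht ht', hr⟩

/-- The rule for a loop whose counter `r` runs down from `N`: `I i` is the invariant after `i`
rounds. -/
theorem loop {r N : ℕ} {I : ℕ → RamState → Prop}
    (hI : ∀ i < N, ∀ s, s.reg r = N - i → I i s →
      Reaches P s T fun s' => s'.reg r = N - (i + 1) ∧ I (i + 1) s')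
    (hr : s.reg r = N) (h0 : I 0 s) :
    Reaches (.loop r P) s (N * (T + 1) + 1) (I N) := by
  suffices H : ∀ d i, i + d = N → ∀ s, s.reg r = d → I i s →
      Reaches (.loop r P) s (d * (T + 1) + 1) (I N) from H N 0 (by omega) s hr h0
  intro d
  induction d with
  | zero =>
    intro i hi s hs hIs
    obtain rfl : i = N := by omega
    exact ⟨s, 1, .loop_done hs, by omega, hIs⟩
  | succ d ih =>
    intro i hi s hs hIs
    obtain ⟨s', t, h, ht, hr', hI'⟩ := hI i (by omega) s (by omega) hIs
    obtain ⟨s'', t', h', ht', hq⟩ := ih (i + 1) (by omega) s' (by omega) hI'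
    refine ⟨s'', _, .loop_step (by omega) h h', ?_, hq⟩
    rw [Nat.add_mul]
    omega

end Reaches

/-- The rounds of `P` are repeated as often as register `n` says; register `r` is the counter and
register `1` is supposed to hold `1`. -/
def RamProg.repeat (r n : ℕ) (P : RamProg) : RamProg :=
  .seq (.seq (.const r 0) (.add r r n)) (.loop r (.seq P (.sub r r 1)))

/-- The rule for `RamProg.repeat`. The body has to preserve the counter and register `1`. -/
theorem Reaches.repeat {P : RamProg} {s : RamState} {r n N T : ℕ} {I : ℕ → RamState → Prop}
    (hr1 : r ≠ 1) (hrn : r ≠ n) (h1 : s.reg 1 = 1) (hn : s.reg n = N)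
    (h0 : ∀ x, I 0 ⟨Function.update s.reg r x, s.mem⟩)
    (hup : ∀ i s x, I i s → I i ⟨Function.update s.reg r x, s.mem⟩)
    (hI : ∀ i < N, ∀ s, s.reg 1 = 1 → I i s →
      Reaches P s T fun s' => s'.reg r = s.reg r ∧ s'.reg 1 = 1 ∧ I (i + 1) s') :
    Reaches (.repeat r n P) s (N * (T + 2) + 3) fun s' => s'.reg 1 = 1 ∧ I N s' := by
  have key : Reaches (.repeat r n P) s (2 + (N * ((T + 1) + 1) + 1))
      fun s' => s'.reg 1 = 1 ∧ I N s' := by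
    refine Reaches.seq (Q := fun s' => s'.reg r = N ∧ s'.reg 1 = 1 ∧ I 0 s')
      (Reaches.of_loopFree rfl ?_) ?_
    · simp only [RamProg.eval]
      refine ⟨?_, ?_, ?_⟩
      · simp [hn, hrn.symm]
      · simp [hr1.symm, h1]
      · simpa using h0 _
    · rintro s' ⟨h1', h2', h3'⟩
      refine Reaches.loop (I := fun i s => s.reg 1 = 1 ∧ I i s) ?_ h1' ⟨h2', h3'⟩
      rintro i hi s hs1 ⟨hs3, hs4⟩
      refine Reaches.seq (hI i hi s hs3 hs4) ?_
      rintro s'' ⟨ha, hb, hc⟩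
      refine Reaches.of_loopFree (P := .sub r r 1) rfl ?_
      simp only [RamProg.eval]
      refine ⟨?_, ?_, hup _ _ _ hc⟩
      · simp [ha, hs1, hb]; omega
      · simp [hr1.symm, hb]
  exact key.mono (by ring_nf; omega) fun _ h => h

/-! ### The clustering program -/

/-- The layer of item `v`: six classes by residue, the class of the residue `2` being divided
further into the `k` layers `2, …, k + 1`. The residues `0` and `1` give the layers `0` and `1`, the
residues `3`, `4`, `5` the layers `k + 2`, `k + 3`, `k + 4`. -/
def layer (k v : ℕ) : ℕ :=
  if 2 < v % 6 then v % 6 + k - 1 else if v % 6 = 2 then (v / 6) % k + 2 else v % 6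

/-- The sign of an entry of the input matrix. -/
def codeSign (c : ℕ) : ℤ := if c = 0 then 0 else if c = 1 then 1 else -1

/-- The scores computed by the algorithm from the signs `A`: in round `j` every item collects the
signed scores of the items of layer `j`; from round `k + 2` on only the signs of the new scores
are kept. -/
def score (n k : ℕ) (A : ℕ → ℤ) : ℕ → ℕ → ℤ
  | 0, v => if v = 0 then 1 else 0
  | j + 1, v =>
    let x := ∑ u ∈ Finset.range n, if layer k u = j then A (v * n + u) * score n k A j u else 0
    if k + 1 < j then if 0 < x then 1 else -1 else x

namespace RamProg

/-- Sequential composition of a list of programs. In the programs below register `1`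
holds the constant `1`; register `40` is never assigned a value other than `0`, so `.add r s 40`
copies register `s` to `r`, and `.const 40 0` serves as the empty instruction. -/
def block : List RamProg → RamProg
  | [] => .const 40 0
  | [P] => P
  | P :: l => .seq P (block l)

/-- Collect the signed score of one item `u` of layer `reg 8` for the item that is served. A score
is a difference of two natural numbers, stored in two arrays; the registers `15` and `16`
accumulate the two numbers, and `14`, `32`, `33`, `34` point to the entry of the input matrix, the
two parts of the score of `u`, and its layer. -/
def collectOne : RamProg := block
  [.load 35 34, .sub 36 35 8, .sub 37 8 35, .add 36 36 37,
   .cond 36 (.const 40 0) (block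
    [.load 37 14, .load 38 32, .load 39 33,
     .cond 37 (block [.sub 37 37 1,
       .cond 37 (block [.add 15 15 39, .add 16 16 38]) (block [.add 15 15 38, .add 16 16 39])])
      (.const 40 0)]),
   .add 14 14 1, .add 32 32 1, .add 33 33 1, .add 34 34 1]

/-- Compute the new score of one item. -/
def collect : RamProg := block
  [block [.const 40 0, .const 15 0, .const 16 0, .add 32 2 40, .add 33 4 40, .add 34 7 40],
   RamProg.repeat 12 0 collectOne,
   block [.store 30 15, .store 31 16, .add 30 30 1, .add 31 31 1]]

/-- Compute the new scores of all items into auxiliary arrays, because the old scores are needed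
until all new ones are known. -/
def collectAll : RamProg := block
  [block [.const 40 0, .const 14 0, .add 30 5 40, .add 31 6 40], RamProg.repeat 10 0 collect]

/-- Copy the new score of one item back, reduced to its sign if `reg 36 ≠ 0`. -/
def copyOne : RamProg := block
  [.load 15 30, .load 16 31,
   .cond 36 (block [.sub 15 15 16,
      .cond 15 (block [.const 15 1, .const 16 0]) (block [.const 15 0, .const 16 1])])
    (.const 40 0),
   .store 32 15, .store 33 16, .add 30 30 1, .add 31 31 1, .add 32 32 1, .add 33 33 1]

/-- Copy the new scores back. -/
def copyAll : RamProg := block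
  [block [.const 40 0, .add 30 5 40, .add 31 6 40, .add 32 2 40, .add 33 4 40, .sub 36 8 28],
   RamProg.repeat 10 0 copyOne]

/-- One round of the algorithm. -/
def round : RamProg := block [collectAll, copyAll, .add 8 8 1]

/-- Find the number of binary digits of `n`: if register `20`, which holds a power of `2`, is at most
`n`, it is doubled and the exponent in register `3` is increased. -/
def sizeOne : RamProg := block
  [.sub 21 20 0, .cond 21 (.const 40 0) (block [.add 20 20 20, .add 3 3 1])]

/-- Write the layer of one item; the registers `22` and `23` hold `v % 6` and `v / 6 % k`. -/
def layerOne : RamProg := block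
  [.const 27 2, .sub 27 22 27,
   .cond 27 (block [.add 26 22 3, .sub 26 26 1])
     (block [.const 27 1, .sub 27 22 27,
       .cond 27 (.add 26 23 22) (block [.const 26 0, .add 26 26 22])]),
   .store 24 26, .add 24 24 1, .add 22 22 1, .const 27 6, .sub 27 27 22,
   .cond 27 (.const 40 0) (block [.const 22 0, .add 23 23 1, .sub 27 3 23,
     .cond 27 (.const 40 0) (.const 23 0)])]

/-- Compute the positions of the arrays, the parameter `k` (into register `3`), the threshold `k + 1`,
the number `k + 5` of rounds, and the layers; then give item `0` the score `1`. -/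
def setup : RamProg := block
  [block [.const 1 1, .const 2 0],
   RamProg.repeat 10 0 (.add 2 2 0),
   block [.const 3 0, .const 20 1],
   RamProg.repeat 10 0 sizeOne,
   block [.const 40 0, .add 4 2 0, .add 5 4 0, .add 6 5 0, .add 7 6 0, .const 22 0, .const 23 0,
     .add 24 7 40, .const 8 0, .const 28 1, .add 28 28 3, .const 29 5, .add 29 29 3],
   RamProg.repeat 10 0 layerOne,
   .store 2 1]

/-- The clustering algorithm. -/
def cluster : RamProg := .seq setup (RamProg.repeat 9 29 round)

end RamProg

/-- The registers that stay fixed during the rounds: `n`, the positions of the arrays, and the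
threshold `k + 1` from which on only signs are kept. -/
def Fixed (n k : ℕ) (s : RamState) : Prop :=
  s.reg 0 = n ∧ s.reg 2 = n * n ∧ s.reg 4 = n * n + n ∧ s.reg 5 = n * n + n + n ∧
    s.reg 6 = n * n + n + n + n ∧ s.reg 7 = n * n + n + n + n + n ∧ s.reg 28 = k + 1

/-- The memory holds the input `A`, the layers, and two arrays that represent the scores `x`. -/
def Holds (n k : ℕ) (A : ℕ → ℕ) (x : ℕ → ℤ) (mem : ℕ → ℕ) : Prop :=
  (∀ i < n * n, mem i = A i) ∧ (∀ v < n, mem (n * n + n + n + n + n + v) = layer k v) ∧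
    ∀ v < n, (mem (n * n + v) : ℤ) - mem (n * n + n + v) = x v

/-- The contribution of one item with input entry `c`, layer `l` and score `x` is added to the
accumulated value `y`. -/
theorem reaches_collectOne {s : RamState} {j l c : ℕ} {x y : ℤ}
    (h1 : s.reg 1 = 1) (h8 : s.reg 8 = j) (hl : s.mem (s.reg 34) = l) (hc : s.mem (s.reg 14) = c)
    (hx : (s.mem (s.reg 32) : ℤ) - s.mem (s.reg 33) = x)
    (hy : (s.reg 15 : ℤ) - s.reg 16 = y) :
    Reaches RamProg.collectOne s 30 fun s' =>
      s'.mem = s.mem ∧ (∀ r, r ≤ 12 ∨ r = 28 ∨ r = 30 ∨ r = 31 → s'.reg r = s.reg r) ∧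
      s'.reg 14 = s.reg 14 + 1 ∧ s'.reg 32 = s.reg 32 + 1 ∧ s'.reg 33 = s.reg 33 + 1 ∧
      s'.reg 34 = s.reg 34 + 1 ∧
      (s'.reg 15 : ℤ) - s'.reg 16 = y + if l = j then codeSign c * x else 0 := by
  refine (Reaches.of_loopFree rfl ?_).mono (T' := 30) (by decide) fun s' h => h
  have hr : ∀ r, r ≤ 12 ∨ r = 28 ∨ r = 30 ∨ r = 31 →
      r ≠ 40 ∧ r ≠ 14 ∧ r ≠ 15 ∧ r ≠ 16 ∧ r ≠ 32 ∧ r ≠ 33 ∧ r ≠ 34 ∧ r ≠ 35 ∧ r ≠ 36 ∧ r ≠ 37 ∧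
      r ≠ 38 ∧ r ≠ 39 := by omega
  by_cases hlj : l = j
  · subst hlj
    by_cases hc0 : c = 0
    · simp [RamProg.collectOne, RamProg.block, RamProg.eval, h1, h8, hl, hc, hc0, codeSign, hy]
      intro r h
      simp [hr r h]
    · by_cases hc1 : c = 1
      · simp [RamProg.collectOne, RamProg.block, RamProg.eval, h1, h8, hl, hc, hc1, codeSign]
        refine ⟨?_, by rw [← hx, ← hy]; ring⟩
        intro r h
        simp [hr r h]
      · have hc2 : c - 1 ≠ 0 := by omega
        simp [RamProg.collectOne, RamProg.block, RamProg.eval, h1, h8, hl, hc, hc0, hc1, hc2,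
          codeSign]
        refine ⟨?_, by rw [← hx, ← hy]; ring⟩
        intro r h
        simp [hr r h]
  · have hne : l - j + (j - l) ≠ 0 := by omega
    generalize hd : l - j = d at hne
    generalize hd' : j - l = d' at hne
    have hne' : (d = 0 → ¬d' = 0) ↔ True := by simp; omega
    simp only [RamProg.collectOne, RamProg.block, RamProg.eval]
    simp [h1, h8, hl, hlj, hne', hy, hd, hd']
    intro r h
    simp [hr r h]

/-- The new score of item `v` is written to the cells given by the registers `30` and `31`. -/
theorem reaches_collect {n k j v : ℕ} {A : ℕ → ℕ} {x : ℕ → ℤ} {s : RamState} (hv : v < n)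
    (h1 : s.reg 1 = 1) (hF : Fixed n k s) (hM : Holds n k A x s.mem) (h8 : s.reg 8 = j)
    (h14 : s.reg 14 = v * n) :
    Reaches RamProg.collect s (n * 32 + 20) fun s' =>
      (∀ r, r ≤ 11 ∨ r = 28 → s'.reg r = s.reg r) ∧ s'.reg 14 = (v + 1) * n ∧
      s'.reg 30 = s.reg 30 + 1 ∧ s'.reg 31 = s.reg 31 + 1 ∧
      ∃ a b : ℕ, s'.mem = Function.update (Function.update s.mem (s.reg 30) a) (s.reg 31) b ∧
        (a : ℤ) - b = ∑ u ∈ Finset.range n,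
          if layer k u = j then codeSign (A (v * n + u)) * x u else 0 := by
  obtain ⟨hA, hL, hX⟩ := hM
  obtain ⟨f0, f2, f4, f5, f6, f7, f28⟩ := hF
  refine Reaches.mono (T := 6 + ((n * (30 + 2) + 3) + 4)) (Reaches.seq
    (Q := fun s' => s'.mem = s.mem ∧
      (∀ r, r ≤ 12 ∨ r = 28 ∨ r = 30 ∨ r = 31 → s'.reg r = s.reg r) ∧
      s'.reg 14 = v * n ∧ s'.reg 32 = n * n ∧ s'.reg 33 = n * n + n ∧
      s'.reg 34 = n * n + n + n + n + n ∧ s'.reg 15 = 0 ∧ s'.reg 16 = 0)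
    (Reaches.of_loopFree rfl ?_) fun s₁ h₁ => Reaches.seq
    (Reaches.repeat (N := n) (T := 30) (I := fun u s' => s'.mem = s.mem ∧
      (∀ r, r ≤ 11 ∨ r = 28 ∨ r = 30 ∨ r = 31 → s'.reg r = s.reg r) ∧
      s'.reg 14 = v * n + u ∧ s'.reg 32 = n * n + u ∧ s'.reg 33 = n * n + n + u ∧
      s'.reg 34 = n * n + n + n + n + n + u ∧ (s'.reg 15 : ℤ) - s'.reg 16 =
        ∑ u ∈ Finset.range u, if layer k u = j then codeSign (A (v * n + u)) * x u else 0)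
      (by decide) (by decide) ?_ ?_ ?_ ?_ ?_) ?_) (by omega) fun s' h => h
  · simp [RamProg.block, RamProg.eval, f2, f4, f7, h14]
    rintro r h
    have : r ≠ 40 ∧ r ≠ 15 ∧ r ≠ 16 ∧ r ≠ 32 ∧ r ≠ 33 ∧ r ≠ 34 := by omega
    simp [this]
  · rw [h₁.2.1 1 (by omega), h1]
  · rw [h₁.2.1 0 (by omega), f0]
  · obtain ⟨a1, a2, a3, a4, a5, a6, a7, a8⟩ := h₁
    intro y
    simp [a1, a3, a4, a5, a6, a7, a8]
    intro r h
    rw [Function.update_of_ne (by omega), a2 r (by omega)]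
  · rintro i s' y ⟨a1, a2, a3, a4, a5, a6, a7⟩
    simp [a1, a3, a4, a5, a6, a7]
    intro r h
    rw [Function.update_of_ne (by omega), a2 r (by omega)]
  · rintro u hu s' hs1 ⟨a1, a2, a3, a4, a5, a6, a7⟩
    have hlt : v * n + u < n * n := by nlinarith
    refine (reaches_collectOne (j := j) hs1 (by rw [a2 8 (by omega), h8])
      (by rw [a6, a1, hL u hu]) (by rw [a3, a1, hA _ hlt]) (by rw [a4, a5, a1, hX u hu]) a7).mono
      le_rfl ?_
    rintro s'' ⟨b1, b2, b3, b4, b5, b6, b7⟩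
    refine ⟨b2 _ (by omega), by rw [b2 _ (by omega), hs1], by rw [b1, a1], ?_, by omega, by omega,
      by omega, by omega, ?_⟩
    · intro r h
      rw [b2 r (by omega), a2 r h]
    · rw [b7, Finset.sum_range_succ]
  · rintro s' ⟨hs1, a1, a2, a3, a4, a5, a6, a7⟩
    refine Reaches.of_loopFree rfl ?_
    simp [RamProg.block, RamProg.eval, a1, a2 30, a2 31, a3, hs1]
    refine ⟨fun r h => ?_, by ring, _, _, rfl, a7⟩
    have : r ≠ 30 ∧ r ≠ 31 := by omega
    simp [this, a2 r (by omega)]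

/-- The new scores are computed into the auxiliary arrays, and the old ones are kept. -/
theorem reaches_collectAll {n k j : ℕ} {A : ℕ → ℕ} {x : ℕ → ℤ} {s : RamState}
    (h1 : s.reg 1 = 1) (hF : Fixed n k s) (hM : Holds n k A x s.mem) (h8 : s.reg 8 = j) :
    Reaches RamProg.collectAll s (n * (n * 32 + 22) + 7) fun s' => s'.reg 1 = 1 ∧
      (∀ r, r ≤ 9 ∨ r = 28 → s'.reg r = s.reg r) ∧ Holds n k A x s'.mem ∧
      ∀ v < n, (s'.mem (n * n + n + n + v) : ℤ) - s'.mem (n * n + n + n + n + v) =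
        ∑ u ∈ Finset.range n, if layer k u = j then codeSign (A (v * n + u)) * x u else 0 := by
  have hF' := hF
  obtain ⟨f0, f2, f4, f5, f6, f7, f28⟩ := hF'
  refine Reaches.mono (T := 4 + (n * ((n * 32 + 20) + 2) + 3)) (Reaches.seq
    (Q := fun s' => s'.mem = s.mem ∧ (∀ r, r ≤ 12 ∨ r = 28 → s'.reg r = s.reg r) ∧
      s'.reg 14 = 0 ∧ s'.reg 30 = n * n + n + n ∧ s'.reg 31 = n * n + n + n + n)
    (Reaches.of_loopFree rfl ?_) fun s₁ h₁ =>
    (Reaches.repeat (N := n) (I := fun v s' => Holds n k A x s'.mem ∧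
      (∀ r, r ≤ 9 ∨ r = 28 → s'.reg r = s.reg r) ∧
      s'.reg 14 = v * n ∧ s'.reg 30 = n * n + n + n + v ∧ s'.reg 31 = n * n + n + n + n + v ∧
      ∀ w < v, (s'.mem (n * n + n + n + w) : ℤ) - s'.mem (n * n + n + n + n + w) =
        ∑ u ∈ Finset.range n, if layer k u = j then codeSign (A (w * n + u)) * x u else 0)
      (by decide) (by decide) ?_ ?_ ?_ ?_ ?_)) (by ring_nf; omega) ?_
  · simp [RamProg.block, RamProg.eval, f5, f6]
    rintro r h
    have : r ≠ 40 ∧ r ≠ 14 ∧ r ≠ 30 ∧ r ≠ 31 := by omega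
    simp [this]
  · rw [h₁.2.1 1 (by omega), h1]
  · rw [h₁.2.1 0 (by omega), f0]
  · obtain ⟨a1, a2, a3, a4, a5⟩ := h₁
    intro y
    simp [a1, a3, a4, a5, hM]
    intro r h
    rw [Function.update_of_ne (by omega), a2 r (by omega)]
  · rintro i s' y ⟨a1, a2, a3, a4, a5, a6⟩
    refine ⟨a1, ?_, by simpa using a3, by simpa using a4, by simpa using a5, a6⟩
    intro r h
    simp only
    rw [Function.update_of_ne (by omega), a2 r (by omega)]
  · rintro v hv s' hs1 ⟨a1, a2, a3, a4, a5, a6⟩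
    refine (reaches_collect hv hs1 ?_ a1 (by rw [a2 8 (by omega), h8]) a3).mono le_rfl ?_
    · refine ⟨?_, ?_, ?_, ?_, ?_, ?_, ?_⟩ <;> rw [a2 _ (by omega)] <;> assumption
    rintro s'' ⟨b1, b2, b3, b4, a, b, b5, b6⟩
    rw [a4, a5] at b5
    refine ⟨b1 _ (by omega), by rw [b1 _ (by omega), hs1], ?_, ?_, b2, by omega, by omega, ?_⟩
    · obtain ⟨hA, hL, hX⟩ := a1
      refine ⟨fun i hi => ?_, fun w hw => ?_, fun w hw => ?_⟩
      · rw [b5, Function.update_of_ne (by omega), Function.update_of_ne (by omega), hA i hi]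
      · rw [b5, Function.update_of_ne (by omega), Function.update_of_ne (by omega), hL w hw]
      · rw [b5, Function.update_of_ne (by omega), Function.update_of_ne (by omega),
          Function.update_of_ne (by omega), Function.update_of_ne (by omega), hX w hw]
    · intro r h
      rw [b1 r (by omega), a2 r h]
    · intro w hw
      rcases Nat.lt_succ_iff_lt_or_eq.1 hw with h | rfl
      · rw [b5, Function.update_of_ne (by omega), Function.update_of_ne (by omega),
          Function.update_of_ne (by omega), Function.update_of_ne (by omega), a6 w h]
      · rw [b5, Function.update_of_ne (by omega), Function.update_self, Function.update_self, b6]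
  · rintro s' ⟨a0, a1, a2, a3, a4, a5, a6⟩
    exact ⟨a0, a2, a1, a6⟩

theorem reaches_copyOne {s : RamState} {a b : ℕ} (h1 : s.reg 1 = 1)
    (ha : s.mem (s.reg 30) = a) (hb : s.mem (s.reg 31) = b) :
    Reaches RamProg.copyOne s 20 fun s' =>
      (∀ r, r ≤ 12 ∨ r = 28 ∨ r = 36 → s'.reg r = s.reg r) ∧
      s'.reg 30 = s.reg 30 + 1 ∧ s'.reg 31 = s.reg 31 + 1 ∧ s'.reg 32 = s.reg 32 + 1 ∧
      s'.reg 33 = s.reg 33 + 1 ∧ s'.mem = Function.update (Function.update s.mem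
        (s.reg 32) (if s.reg 36 = 0 then a else if b < a then 1 else 0))
        (s.reg 33) (if s.reg 36 = 0 then b else if b < a then 0 else 1) := by
  refine (Reaches.of_loopFree rfl ?_).mono (T' := 20) (by decide) fun s' h => h
  have hr : ∀ r, r ≤ 12 ∨ r = 28 ∨ r = 36 → r ≠ 40 ∧ r ≠ 15 ∧ r ≠ 16 ∧ r ≠ 30 ∧ r ≠ 31 ∧
      r ≠ 32 ∧ r ≠ 33 := by omega
  by_cases h36 : s.reg 36 = 0
  · simp [RamProg.copyOne, RamProg.block, RamProg.eval, h1, ha, hb, h36]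
    intro r h
    simp [hr r h]
  · by_cases hab : b < a
    · have : a - b ≠ 0 := by omega
      simp [RamProg.copyOne, RamProg.block, RamProg.eval, h1, ha, hb, h36, this, hab]
      intro r h
      simp [hr r h]
    · have : a - b = 0 := by omega
      simp [RamProg.copyOne, RamProg.block, RamProg.eval, h1, ha, hb, h36, this, hab]
      intro r h
      simp [hr r h]

/-- The new scores `y` replace the old ones, as signs if `k + 1 < j`. In that case the first array
of scores indicates the positive ones, which is the form of the output. -/
theorem reaches_copyAll {n k j : ℕ} {A : ℕ → ℕ} {x y : ℕ → ℤ} {s : RamState}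
    (h1 : s.reg 1 = 1) (hF : Fixed n k s) (hM : Holds n k A x s.mem) (h8 : s.reg 8 = j)
    (hy : ∀ v < n, (s.mem (n * n + n + n + v) : ℤ) - s.mem (n * n + n + n + n + v) = y v) :
    Reaches RamProg.copyAll s (n * 22 + 9) fun s' => s'.reg 1 = 1 ∧
      (∀ r, r ≤ 9 ∨ r = 28 → s'.reg r = s.reg r) ∧
      Holds n k A (fun v => if k + 1 < j then if 0 < y v then 1 else -1 else y v) s'.mem ∧
      (k + 1 < j → ∀ v < n, s'.mem (n * n + v) = if 0 < y v then 1 else 0) := by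
  obtain ⟨f0, f2, f4, f5, f6, f7, f28⟩ := hF
  have h36 : j - (k + 1) = 0 ↔ ¬ k + 1 < j := by omega
  refine Reaches.mono (T := 6 + (n * (20 + 2) + 3)) (Reaches.seq
    (Q := fun s' => s'.mem = s.mem ∧ (∀ r, r ≤ 12 ∨ r = 28 → s'.reg r = s.reg r) ∧
      s'.reg 36 = j - (k + 1) ∧ s'.reg 30 = n * n + n + n ∧ s'.reg 31 = n * n + n + n + n ∧
      s'.reg 32 = n * n ∧ s'.reg 33 = n * n + n)
    (Reaches.of_loopFree rfl ?_) fun s₁ h₁ =>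
    (Reaches.repeat (N := n) (I := fun v s' =>
      (∀ i, i < n * n ∨ n * n + n + n ≤ i → s'.mem i = s.mem i) ∧
      (∀ r, r ≤ 9 ∨ r = 28 → s'.reg r = s.reg r) ∧ s'.reg 36 = j - (k + 1) ∧
      s'.reg 30 = n * n + n + n + v ∧ s'.reg 31 = n * n + n + n + n + v ∧
      s'.reg 32 = n * n + v ∧ s'.reg 33 = n * n + n + v ∧
      ∀ w < v, (s'.mem (n * n + w) : ℤ) - s'.mem (n * n + n + w) =
        (if k + 1 < j then if 0 < y w then 1 else -1 else y w) ∧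
        (k + 1 < j → s'.mem (n * n + w) = if 0 < y w then 1 else 0))
      (by decide) (by decide) ?_ ?_ ?_ ?_ ?_)) (by omega) ?_
  · simp [RamProg.block, RamProg.eval, f2, f4, f5, f6, f28, h8]
    rintro r h
    have : r ≠ 40 ∧ r ≠ 36 ∧ r ≠ 30 ∧ r ≠ 31 ∧ r ≠ 32 ∧ r ≠ 33 := by omega
    simp [this]
  · rw [h₁.2.1 1 (by omega), h1]
  · rw [h₁.2.1 0 (by omega), f0]
  · obtain ⟨a1, a2, a3, a4, a5, a6, a7⟩ := h₁
    intro y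
    simp [a1, a3, a4, a5, a6, a7]
    intro r h
    rw [Function.update_of_ne (by omega), a2 r (by omega)]
  · rintro i s' y ⟨a1, a2, a3, a4, a5, a6, a7, a8⟩
    refine ⟨a1, ?_, by simpa using a3, by simpa using a4, by simpa using a5, by simpa using a6,
      by simpa using a7, a8⟩
    intro r h
    simp only
    rw [Function.update_of_ne (by omega), a2 r (by omega)]
  · rintro v hv s' hs1 ⟨a1, a2, a3, a4, a5, a6, a7, a8⟩
    refine (reaches_copyOne hs1 rfl rfl).mono le_rfl ?_
    rintro s'' ⟨b1, b2, b3, b4, b5, b6⟩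
    rw [a3, a4, a5, a6, a7, a1 _ (by omega), a1 _ (by omega)] at b6
    refine ⟨b1 _ (by omega), by rw [b1 _ (by omega), hs1], ?_, ?_, ?_, by omega, by omega,
      by omega, by omega, ?_⟩
    · intro i hi
      rw [b6, Function.update_of_ne (by omega), Function.update_of_ne (by omega), a1 i hi]
    · intro r h
      rw [b1 r (by omega), a2 r h]
    · rw [b1 _ (by omega), a3]
    · intro w hw
      rcases Nat.lt_succ_iff_lt_or_eq.1 hw with h | rfl
      · rw [b6, Function.update_of_ne (by omega), Function.update_of_ne (by omega),
          Function.update_of_ne (by omega), Function.update_of_ne (by omega)]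
        exact a8 w h
      · rw [b6, Function.update_of_ne (by omega), Function.update_self, Function.update_self]
        have := hy w hv
        have hpos : s.mem (n * n + n + n + n + w) < s.mem (n * n + n + n + w) ↔ 0 < y w := by
          omega
        simp only [h36, hpos]
        by_cases hj : k + 1 < j
        · simp only [hj, not_true_eq_false, if_false, if_true, true_implies, and_true]
          split_ifs <;> simp
        · simp [hj, this]
  · rintro s' ⟨a0, a1, a2, a3, a4, a5, a6, a7, a8⟩
    obtain ⟨hA, hL, hX⟩ := hM
    refine ⟨a0, a2, ⟨fun i hi => ?_, fun v hv => ?_, fun v hv => (a8 v hv).1⟩,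
      fun hj v hv => (a8 v hv).2 hj⟩
    · rw [a1 i (Or.inl hi), hA i hi]
    · rw [a1 _ (by omega), hL v hv]

/-- One round takes the scores of index `j` to those of index `j + 1`. -/
theorem reaches_round {n k j : ℕ} {A : ℕ → ℕ} {s : RamState}
    (h1 : s.reg 1 = 1) (hF : Fixed n k s)
    (hM : Holds n k A (score n k (fun i => codeSign (A i)) j) s.mem) (h8 : s.reg 8 = j) :
    Reaches RamProg.round s (n * (n * 32 + 44) + 17) fun s' => s'.reg 1 = 1 ∧
      Fixed n k s' ∧ s'.reg 9 = s.reg 9 ∧ s'.reg 8 = j + 1 ∧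
      Holds n k A (score n k (fun i => codeSign (A i)) (j + 1)) s'.mem ∧
      (k + 1 < j → ∀ v < n, s'.mem (n * n + v) =
        if 0 < score n k (fun i => codeSign (A i)) (j + 1) v then 1 else 0) := by
  refine Reaches.mono (T := (n * (n * 32 + 22) + 7) + ((n * 22 + 9) + 1)) (Reaches.seq
    (reaches_collectAll h1 hF hM h8) fun s₁ h₁ => Reaches.seq
    (reaches_copyAll (j := j) (y := fun v => ∑ u ∈ Finset.range n, if layer k u = j then
      codeSign (A (v * n + u)) * score n k (fun i => codeSign (A i)) j u else 0)
      h₁.1 ?_ h₁.2.2.1 ?_ h₁.2.2.2) fun s₂ h₂ => Reaches.of_loopFree rfl (Q := fun s' =>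
      s'.reg 1 = 1 ∧
      Fixed n k s' ∧ s'.reg 9 = s.reg 9 ∧ s'.reg 8 = j + 1 ∧
      Holds n k A (score n k (fun i => codeSign (A i)) (j + 1)) s'.mem ∧
      (k + 1 < j → ∀ v < n, s'.mem (n * n + v) =
        if 0 < score n k (fun i => codeSign (A i)) (j + 1) v then 1 else 0)) ?_)
      (by ring_nf; omega) fun _ h => h
  · obtain ⟨f0, f2, f4, f5, f6, f7, f28⟩ := hF
    refine ⟨?_, ?_, ?_, ?_, ?_, ?_, ?_⟩ <;> rw [h₁.2.1 _ (by omega)] <;> assumption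
  · rw [h₁.2.1 _ (by omega), h8]
  · obtain ⟨c1, c2, c3, c4⟩ := h₂
    obtain ⟨d1, d2, d3, d4⟩ := h₁
    obtain ⟨f0, f2, f4, f5, f6, f7, f28⟩ := hF
    have e : ∀ r, r ≤ 9 ∨ r = 28 → s₂.reg r = s.reg r := fun r h => by rw [c2 r h, d2 r h]
    refine ⟨?_, ⟨?_, ?_, ?_, ?_, ?_, ?_, ?_⟩, ?_, ?_, ?_, ?_⟩
    any_goals simp [RamProg.block, RamProg.eval, e, f0, f2, f4, f5, f6, f7, f28, h1, h8]
    · exact c3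
    · intro hj v hv
      rw [c4 hj v hv]
      simp only [score, if_pos hj]
      split_ifs <;> simp_all

/-- After `i` steps register `3` holds `min i n.size`. -/
theorem reaches_sizeOne {n i : ℕ} {s : RamState} (h0 : s.reg 0 = n)
    (h1 : s.reg 1 = 1) (h3 : s.reg 3 = min i n.size) (h20 : s.reg 20 = 2 ^ min i n.size) :
    Reaches RamProg.sizeOne s 6 fun s' => s'.mem = s.mem ∧
      (∀ r, r ≠ 3 ∧ r ≠ 20 ∧ r ≠ 21 ∧ r ≠ 40 → s'.reg r = s.reg r) ∧
      s'.reg 3 = min (i + 1) n.size ∧ s'.reg 20 = 2 ^ min (i + 1) n.size := by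
  refine (Reaches.of_loopFree rfl ?_).mono (T' := 6) (by decide) fun s' h => h
  rcases Nat.lt_or_ge i n.size with h | h
  · have hle : 2 ^ i ≤ n := Nat.lt_size.1 h
    rw [min_eq_left h.le] at h3 h20
    rw [min_eq_left (by omega : i + 1 ≤ n.size)]
    simp [RamProg.sizeOne, RamProg.block, RamProg.eval, h0, h1, h3, h20, Nat.sub_eq_zero_of_le hle]
    refine ⟨fun r h3 h20 h21 h40 => by simp [*], by ring⟩
  · have hlt : n < 2 ^ n.size := Nat.lt_size_self n
    have hne : 2 ^ n.size - n ≠ 0 := by omega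
    rw [min_eq_right h] at h3 h20
    rw [min_eq_right (by omega : n.size ≤ i + 1)]
    simp [RamProg.sizeOne, RamProg.block, RamProg.eval, h0, h3, h20, hne]
    exact fun r h3 h20 h21 h40 => by simp [*]

theorem reaches_layerOne {k v : ℕ} {s : RamState} (hk : 0 < k) (h1 : s.reg 1 = 1)
    (h3 : s.reg 3 = k) (h22 : s.reg 22 = v % 6) (h23 : s.reg 23 = v / 6 % k) :
    Reaches RamProg.layerOne s 30 fun s' =>
      s'.mem = Function.update s.mem (s.reg 24) (layer k v) ∧
      (∀ r, r ≤ 12 ∨ r = 28 ∨ r = 29 → s'.reg r = s.reg r) ∧ s'.reg 24 = s.reg 24 + 1 ∧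
      s'.reg 22 = (v + 1) % 6 ∧ s'.reg 23 = (v + 1) / 6 % k := by
  refine (Reaches.of_loopFree rfl ?_).mono (T' := 30) (by decide) fun s' h => h
  have hr : ∀ r, r ≤ 12 ∨ r = 28 ∨ r = 29 → r ≠ 22 ∧ r ≠ 23 ∧ r ≠ 24 ∧ r ≠ 26 ∧ r ≠ 27 ∧
      r ≠ 40 := by omega
  have hlt : v % 6 < 6 := Nat.mod_lt _ (by norm_num)
  have hik : v / 6 % k < k := Nat.mod_lt _ hk
  have hmod : (v / 6 + 1) % k = if k - (v / 6 % k + 1) = 0 then 0 else v / 6 % k + 1 := by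
    rw [Nat.add_mod]
    split_ifs with h
    · rcases Nat.lt_or_ge 1 k with h' | h'
      · rw [Nat.mod_eq_of_lt h', show v / 6 % k + 1 = k by omega, Nat.mod_self]
      · obtain rfl : k = 1 := by omega
        simp [Nat.mod_one]
    · rw [Nat.mod_eq_of_lt (show 1 < k by omega), Nat.mod_eq_of_lt (by omega)]
  have hm : (v + 1) % 6 = if v % 6 = 5 then 0 else v % 6 + 1 := by split_ifs <;> omega
  have hd : (v + 1) / 6 = if v % 6 = 5 then v / 6 + 1 else v / 6 := by split_ifs <;> omega
  rw [hm, hd]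
  generalize hc : v % 6 = c at *
  generalize hw : v / 6 % k = i at *
  have hl : layer k v = if 2 < c then c + k - 1 else if c = 2 then i + 2 else c := by
    rw [layer, hc, hw]
  rw [hl]
  interval_cases c
  · simp [RamProg.layerOne, RamProg.block, RamProg.eval, h1, h22, h23, hw]
    intro r h; simp [hr r h]
  · simp [RamProg.layerOne, RamProg.block, RamProg.eval, h1, h22, h23, hw]
    intro r h; simp [hr r h]
  · simp [RamProg.layerOne, RamProg.block, RamProg.eval, h1, h22, h23, hw]
    intro r h; simp [hr r h]
  · simp [RamProg.layerOne, RamProg.block, RamProg.eval, h1, h3, h22, h23, hw]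
    intro r h; simp [hr r h]
  · simp [RamProg.layerOne, RamProg.block, RamProg.eval, h1, h3, h22, h23, hw]
    intro r h; simp [hr r h]
  · by_cases h : k - (i + 1) = 0
    · simp [RamProg.layerOne, RamProg.block, RamProg.eval, h1, h3, h22, h23, hmod, h]
      intro r h; simp [hr r h]
    · simp [RamProg.layerOne, RamProg.block, RamProg.eval, h1, h3, h22, h23, hmod, h]
      intro r h; simp [hr r h]

set_option maxHeartbeats 1000000 in
/-- After the preparations the memory holds the input, the layers, and the initial scores. -/
theorem reaches_setup {n : ℕ} (s : RamState) (A : ℕ → ℕ) (hA : ∀ i < n * n, s.mem i = A i)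
    (hA' : ∀ i, n * n ≤ i → s.mem i = 0) (h0 : s.reg 0 = n) :
    Reaches RamProg.setup s (n * 50 + 50) fun s' => s'.reg 1 = 1 ∧ Fixed n n.size s' ∧
      s'.reg 8 = 0 ∧ s'.reg 29 = n.size + 5 ∧
      Holds n n.size A (score n n.size (fun i => codeSign (A i)) 0) s'.mem := by
  set k := n.size with hkdef
  have hkn : k ≤ n := Nat.size_le.2 Nat.lt_two_pow_self
  refine Reaches.mono (T := 2 + ((n * (1 + 2) + 3) + (2 + ((n * (6 + 2) + 3) + (13 +
    ((n * (30 + 2) + 3) + 1)))))) (Reaches.seq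
    (Q := fun s' => s'.mem = s.mem ∧ s'.reg 0 = n ∧ s'.reg 1 = 1 ∧ s'.reg 2 = 0)
    (Reaches.of_loopFree rfl ?_) fun s₁ h₁ => Reaches.seq
    (Reaches.repeat (N := n) (I := fun i s' => s'.mem = s.mem ∧ s'.reg 0 = n ∧ s'.reg 2 = i * n)
      (by decide) (by decide) ?_ ?_ ?_ ?_ ?_) fun s₂ h₂ => Reaches.seq
    (Q := fun s' => s'.mem = s.mem ∧ s'.reg 0 = n ∧ s'.reg 1 = 1 ∧ s'.reg 2 = n * n ∧
      s'.reg 3 = 0 ∧ s'.reg 20 = 1)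
    (Reaches.of_loopFree rfl ?_) fun s₃ h₃ => Reaches.seq
    (Reaches.repeat (N := n) (I := fun i s' => s'.mem = s.mem ∧ s'.reg 0 = n ∧ s'.reg 2 = n * n ∧
      s'.reg 3 = min i k ∧ s'.reg 20 = 2 ^ min i k)
      (by decide) (by decide) ?_ ?_ ?_ ?_ ?_) fun s₄ h₄ => Reaches.seq
    (Q := fun s' => s'.mem = s.mem ∧ Fixed n k s' ∧ s'.reg 1 = 1 ∧ s'.reg 3 = k ∧ s'.reg 22 = 0 ∧
      s'.reg 23 = 0 ∧ s'.reg 24 = n * n + n + n + n + n ∧ s'.reg 8 = 0 ∧ s'.reg 29 = k + 5)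
    (Reaches.of_loopFree rfl ?_) fun s₅ h₅ => Reaches.seq
    (Reaches.repeat (N := n) (I := fun v s' => Fixed n k s' ∧ s'.reg 3 = k ∧ s'.reg 22 = v % 6 ∧
      s'.reg 23 = v / 6 % k ∧ s'.reg 24 = n * n + n + n + n + n + v ∧ s'.reg 8 = 0 ∧
      s'.reg 29 = k + 5 ∧ (∀ i < n * n, s'.mem i = A i) ∧
      (∀ i < n, s'.mem (n * n + i) = 0 ∧ s'.mem (n * n + n + i) = 0) ∧
      ∀ w < v, s'.mem (n * n + n + n + n + n + w) = layer k w)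
      (by decide) (by decide) ?_ ?_ ?_ ?_ ?_) fun s₆ h₆ =>
      (Reaches.of_loopFree (P := .store 2 1) rfl (Q := fun s' => s'.reg 1 = 1 ∧ Fixed n k s' ∧
      s'.reg 8 = 0 ∧ s'.reg 29 = k + 5 ∧
      Holds n k A (score n k (fun i => codeSign (A i)) 0) s'.mem) ?_)) (by omega) fun _ h => h
  · simp [RamProg.block, RamProg.eval, h0]
  · exact h₁.2.2.1
  · exact h₁.2.1
  · simp [h₁]
  · rintro i s' x ⟨a1, a2, a3⟩
    simp [a1, a2, a3]
  · rintro i hi s' hs1 ⟨a1, a2, a3⟩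
    refine Reaches.of_loopFree (P := .add 2 2 0) rfl ?_
    simp [RamProg.eval, a1, a2, a3, hs1]
    ring
  · obtain ⟨a0, a1, a2, a3⟩ := h₂
    simp [RamProg.block, RamProg.eval, a0, a1, a2, a3]
  · exact h₃.2.2.1
  · exact h₃.2.1
  · obtain ⟨a0, a1, a2, a3, a4, a5⟩ := h₃
    simp [a0, a1, a3, a4, a5]
  · rintro i s' x ⟨a1, a2, a3, a4, a5⟩
    simp [a1, a2, a3, a4, a5]
  · rintro i hi s' hs1 ⟨a1, a2, a3, a4, a5⟩
    refine (reaches_sizeOne a2 hs1 a4 a5).mono le_rfl ?_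
    rintro s'' ⟨b1, b2, b3, b4⟩
    refine ⟨b2 _ (by decide), by rw [b2 _ (by decide), hs1], by rw [b1, a1],
      by rw [b2 _ (by decide), a2], by rw [b2 _ (by decide), a3], b3, b4⟩
  · obtain ⟨a0, a1, a2, a3, a4, a5⟩ := h₄
    rw [min_eq_right hkn] at a4
    simp [RamProg.block, RamProg.eval, Fixed, a0, a1, a2, a3, a4, add_comm]
  · exact h₅.2.2.1
  · exact h₅.2.1.1
  · obtain ⟨a0, a1, a2, a3, a4, a5, a6, a7, a8⟩ := h₅
    obtain ⟨f0, f2, f4, f5, f6, f7, f28⟩ := a1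
    intro x
    simp [Fixed, a0, f0, f2, f4, f5, f6, f7, f28, a3, a4, a5, a6, a7, a8]
    exact ⟨hA, fun i hi => ⟨hA' _ (by omega), hA' _ (by omega)⟩⟩
  · rintro i s' x ⟨a1, a2, a3, a4, a5, a6, a7, a8, a9⟩
    obtain ⟨f0, f2, f4, f5, f6, f7, f28⟩ := a1
    simp [Fixed, f0, f2, f4, f5, f6, f7, f28, a2, a3, a4, a5, a6, a7]
    exact ⟨a8, a9⟩
  · rintro v hv s' hs1 ⟨a1, a2, a3, a4, a5, a6, a7, a8, a9, a10⟩
    have hk0 : 0 < k := Nat.size_pos.2 (by omega)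
    refine (reaches_layerOne hk0 hs1 a2 a3 a4).mono le_rfl ?_
    rintro s'' ⟨b1, b2, b3, b4, b5⟩
    rw [a5] at b1
    obtain ⟨f0, f2, f4, f5, f6, f7, f28⟩ := a1
    refine ⟨b2 _ (by decide), by rw [b2 _ (by decide), hs1], ?_, by rw [b2 _ (by decide), a2],
      b4, b5, by omega, by rw [b2 _ (by decide), a6], by rw [b2 _ (by decide), a7], ?_, ?_, ?_⟩
    · refine ⟨?_, ?_, ?_, ?_, ?_, ?_, ?_⟩ <;> rw [b2 _ (by decide)] <;> assumption
    · intro i hi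
      rw [b1, Function.update_of_ne (by omega), a8 i hi]
    · intro i hi
      rw [b1, Function.update_of_ne (by omega), Function.update_of_ne (by omega)]
      exact a9 i hi
    · intro w hw
      rcases Nat.lt_succ_iff_lt_or_eq.1 hw with h | rfl
      · rw [b1, Function.update_of_ne (by omega), a10 w h]
      · rw [b1, Function.update_self]
  · obtain ⟨a0, a1, a2, a3, a4, a5, a6, a7, a8, a9, a10⟩ := h₆
    refine ⟨a0, a1, a6, a7, ?_, ?_, ?_⟩
    · intro i hi
      simp only [RamProg.eval]
      rw [a1.2.1, Function.update_of_ne (by omega), a8 i hi]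
    · intro v hv
      simp only [RamProg.eval]
      rw [a1.2.1, Function.update_of_ne (by omega), a10 v hv]
    · intro v hv
      simp only [RamProg.eval]
      rw [a1.2.1, a0, Function.update_of_ne (show n * n + n + v ≠ n * n by omega), (a9 v hv).2,
        score]
      split_ifs with h
      · subst h; simp
      · rw [Function.update_of_ne (by omega), (a9 v hv).1]; simp

/-- The program halts within cubic time, and its output indicates the sign of the score after
`k + 5` rounds. -/
theorem reaches_cluster {n : ℕ} (a : Answers n) :
    Reaches RamProg.cluster (initState n a) (1000 * (n + 10) ^ 3) fun s' => ∀ v < n,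
      s'.mem (n * n + v) = 0 ↔
        ¬ 0 < score n n.size (fun i => codeSign ((initState n a).mem i)) (n.size + 5) v := by
  set k := n.size with hkdef
  have hkn : k ≤ n := Nat.size_le.2 Nat.lt_two_pow_self
  set A := (initState n a).mem with hAdef
  refine Reaches.mono (T := (n * 50 + 50) + ((k + 5) * ((n * (n * 32 + 44) + 17) + 2) + 3))
    (Reaches.seq (reaches_setup (initState n a) A (fun _ _ => rfl) ?_ rfl) fun s₁ h₁ =>
    (Reaches.repeat (N := k + 5) (I := fun j s' => Fixed n k s' ∧ s'.reg 8 = j ∧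
      Holds n k A (score n k (fun i => codeSign (A i)) j) s'.mem ∧
      (k + 2 < j → ∀ v < n, s'.mem (n * n + v) =
        if 0 < score n k (fun i => codeSign (A i)) j v then 1 else 0))
      (by decide) (by decide) ?_ ?_ ?_ ?_ ?_)) ?_ ?_
  · intro i hi
    simp [initState, hi.not_gt]
  · exact h₁.1
  · exact h₁.2.2.2.1
  · obtain ⟨b0, b1, b2, b3, b4⟩ := h₁
    intro x
    refine ⟨?_, by simpa using b2, b4, by omega⟩
    simpa [Fixed] using b1
  · rintro i s' x ⟨a1, a2, a3, a4⟩
    exact ⟨by simpa [Fixed] using a1, by simpa using a2, a3, a4⟩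
  · rintro j hj s' hs1 ⟨a1, a2, a3, a4⟩
    refine (reaches_round hs1 a1 a3 a2).mono le_rfl ?_
    rintro s'' ⟨b1, b2, b3, b4, b5, b6⟩
    exact ⟨b3, b1, b2, b4, b5, fun h => b6 (by omega)⟩
  · have h1 : (k + 5) * ((n * (n * 32 + 44) + 17) + 2) ≤
        (n + 5) * ((n * (n * 32 + 44) + 17) + 2) := Nat.mul_le_mul_right _ (by omega)
    refine (Nat.add_le_add_left (Nat.add_le_add_right h1 3) _).trans ?_
    ring_nf
    nlinarith [sq_nonneg n]
  · rintro s' ⟨c1, c2, c3, c4, c5⟩ v hv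
    rw [c5 (by omega) v hv]
    split_ifs with h <;> simp [h]

/-! ### Averages over random queries and random errors -/

section Averages

variable {β : Type*} [DecidableEq β]

/-- The answers relative to the truth: `1` for a correct answer, `-1` for a corrupted one, `0` for a
pair that was not queried. -/
def signs (E X : Finset β) : β → ℝ := fun e => if e ∈ E then if e ∈ X then -1 else 1 else 0

/-- The average over the corrupted queries, for a fixed set `E` of queries. -/
noncomputable def noiseAvg (q : ℝ) (E : Finset β) (F : (β → ℝ) → ℝ) : ℝ :=
  ∑ X ∈ E.powerset, q ^ X.card * (1 - q) ^ (E \ X).card * F (signs E X)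

/-- The average in the binomial model, where every element of `S` is queried independently with
probability `p`. -/
noncomputable def binAvg (S : Finset β) (p q : ℝ) (F : (β → ℝ) → ℝ) : ℝ :=
  ∑ E ∈ S.powerset, p ^ E.card * (1 - p) ^ (S \ E).card * noiseAvg q E F

/-- The average in the uniform model, where a uniformly random set of `m` elements of `S` is
queried. -/
noncomputable def unifAvg (S : Finset β) (m : ℕ) (q : ℝ) (F : (β → ℝ) → ℝ) : ℝ :=
  ∑ E ∈ S.powersetCard m, ((S.card.choose m : ℕ) : ℝ)⁻¹ * noiseAvg q E F

section Linear

variable (S E : Finset β) (m : ℕ) (p q : ℝ) (F G : (β → ℝ) → ℝ) (c : ℝ)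

theorem noiseAvg_add : noiseAvg q E (fun s => F s + G s) = noiseAvg q E F + noiseAvg q E G := by
  simp only [noiseAvg, mul_add, Finset.sum_add_distrib]

theorem noiseAvg_const_mul : noiseAvg q E (fun s => c * F s) = c * noiseAvg q E F := by
  simp only [noiseAvg, Finset.mul_sum]
  exact Finset.sum_congr rfl fun _ _ => by ring

theorem noiseAvg_sum {ι : Type*} (I : Finset ι) (F : ι → (β → ℝ) → ℝ) :
    noiseAvg q E (fun s => ∑ i ∈ I, F i s) = ∑ i ∈ I, noiseAvg q E (F i) := by
  simp only [noiseAvg, Finset.mul_sum]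
  exact Finset.sum_comm

theorem binAvg_add : binAvg S p q (fun s => F s + G s) = binAvg S p q F + binAvg S p q G := by
  simp only [binAvg, noiseAvg_add, mul_add, Finset.sum_add_distrib]

theorem binAvg_const_mul : binAvg S p q (fun s => c * F s) = c * binAvg S p q F := by
  simp only [binAvg, noiseAvg_const_mul, Finset.mul_sum]
  exact Finset.sum_congr rfl fun _ _ => by ring

theorem binAvg_sum {ι : Type*} (I : Finset ι) (F : ι → (β → ℝ) → ℝ) :
    binAvg S p q (fun s => ∑ i ∈ I, F i s) = ∑ i ∈ I, binAvg S p q (F i) := by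
  simp only [binAvg, noiseAvg_sum, Finset.mul_sum]
  exact Finset.sum_comm

theorem unifAvg_add : unifAvg S m q (fun s => F s + G s) = unifAvg S m q F + unifAvg S m q G := by
  simp only [unifAvg, noiseAvg_add, mul_add, Finset.sum_add_distrib]

theorem unifAvg_const_mul : unifAvg S m q (fun s => c * F s) = c * unifAvg S m q F := by
  simp only [unifAvg, noiseAvg_const_mul, Finset.mul_sum]
  exact Finset.sum_congr rfl fun _ _ => by ring

theorem unifAvg_sum {ι : Type*} (I : Finset ι) (F : ι → (β → ℝ) → ℝ) :
    unifAvg S m q (fun s => ∑ i ∈ I, F i s) = ∑ i ∈ I, unifAvg S m q (F i) := by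
  simp only [unifAvg, noiseAvg_sum, Finset.mul_sum]
  exact Finset.sum_comm

variable {S E m p q F G}

theorem noiseAvg_mono (hq : 0 ≤ q) (hq1 : q ≤ 1) (h : ∀ s, F s ≤ G s) :
    noiseAvg q E F ≤ noiseAvg q E G :=
  Finset.sum_le_sum fun _ _ => mul_le_mul_of_nonneg_left (h _)
    (mul_nonneg (pow_nonneg hq _) (pow_nonneg (by linarith) _))

theorem binAvg_mono (hp : 0 ≤ p) (hp1 : p ≤ 1) (hq : 0 ≤ q) (hq1 : q ≤ 1) (h : ∀ s, F s ≤ G s) :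
    binAvg S p q F ≤ binAvg S p q G :=
  Finset.sum_le_sum fun _ _ => mul_le_mul_of_nonneg_left (noiseAvg_mono hq hq1 h)
    (mul_nonneg (pow_nonneg hp _) (pow_nonneg (by linarith) _))

theorem unifAvg_mono (hq : 0 ≤ q) (hq1 : q ≤ 1) (h : ∀ s, F s ≤ G s) :
    unifAvg S m q F ≤ unifAvg S m q G :=
  Finset.sum_le_sum fun _ _ => mul_le_mul_of_nonneg_left (noiseAvg_mono hq hq1 h) (by positivity)

theorem noiseAvg_nonneg (hq : 0 ≤ q) (hq1 : q ≤ 1) (h : ∀ s, 0 ≤ F s) : 0 ≤ noiseAvg q E F :=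
  Finset.sum_nonneg fun _ _ =>
    mul_nonneg (mul_nonneg (pow_nonneg hq _) (pow_nonneg (by linarith) _)) (h _)

theorem binAvg_nonneg (hp : 0 ≤ p) (hp1 : p ≤ 1) (hq : 0 ≤ q) (hq1 : q ≤ 1) (h : ∀ s, 0 ≤ F s) :
    0 ≤ binAvg S p q F :=
  Finset.sum_nonneg fun _ _ => mul_nonneg (mul_nonneg (pow_nonneg hp _)
    (pow_nonneg (by linarith) _)) (noiseAvg_nonneg hq hq1 h)

theorem noiseAvg_one : noiseAvg q E (fun _ => 1) = 1 := by
  have := Finset.prod_add (fun _ : β => q) (fun _ => 1 - q) E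
  simp only [Finset.prod_const, add_sub_cancel, one_pow] at this
  simp only [noiseAvg, mul_one]
  exact this.symm

theorem binAvg_one : binAvg S p q (fun _ => 1) = 1 := by
  have := Finset.prod_add (fun _ : β => p) (fun _ => 1 - p) S
  simp only [Finset.prod_const, add_sub_cancel, one_pow] at this
  simp only [binAvg, noiseAvg_one, mul_one]
  exact this.symm

theorem unifAvg_one (hm : m ≤ S.card) : unifAvg S m q (fun _ => 1) = 1 := by
  have : (S.card.choose m : ℝ) ≠ 0 := by exact_mod_cast (Nat.choose_pos hm).ne'
  simp [unifAvg, noiseAvg_one, Finset.card_powersetCard, this]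

end Linear

/-! ### Resampling one query -/

theorem noiseAvg_insert {q : ℝ} {E : Finset β} {e : β} (he : e ∉ E) (F : (β → ℝ) → ℝ) :
    noiseAvg q (insert e E) F = (1 - q) * noiseAvg q E (fun s => F (Function.update s e 1)) +
      q * noiseAvg q E (fun s => F (Function.update s e (-1))) := by
  simp only [noiseAvg]
  rw [Finset.sum_powerset_insert he, Finset.mul_sum, Finset.mul_sum]
  congr 1 <;> refine Finset.sum_congr rfl fun X hX => ?_
  · have heX : e ∉ X := fun h => he (Finset.mem_powerset.1 hX h)
    have h1 : signs (insert e E) X = Function.update (signs E X) e 1 := by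
      ext a
      by_cases h : a = e
      · subst h; simp [signs, heX]
      · simp [signs, h]
    rw [h1, Finset.insert_sdiff_of_notMem _ heX,
      Finset.card_insert_of_notMem fun h => he (Finset.mem_sdiff.1 h).1]
    ring
  · have heX : e ∉ X := fun h => he (Finset.mem_powerset.1 hX h)
    have h1 : signs (insert e E) (insert e X) = Function.update (signs E X) e (-1) := by
      ext a
      by_cases h : a = e
      · subst h; simp [signs]
      · simp [signs, h]
    rw [h1, Finset.insert_sdiff_insert, Finset.sdiff_insert_of_notMem he,
      Finset.card_insert_of_notMem heX]
    ring

theorem noiseAvg_update_zero {q : ℝ} {E : Finset β} {e : β} (he : e ∉ E) (F : (β → ℝ) → ℝ) :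
    noiseAvg q E (fun s => F (Function.update s e 0)) = noiseAvg q E F := by
  refine Finset.sum_congr rfl fun X _ => ?_
  have h : Function.update (signs E X) e 0 = signs E X :=
    Function.update_eq_self_iff.2 (by rw [signs, if_neg he])
  simp only [h]

/-- One query at a time: whether `e` is queried, and whether its answer is corrupted, is decided
independently of everything else. -/
theorem binAvg_insert {p q : ℝ} {S : Finset β} {e : β} (he : e ∉ S) (F : (β → ℝ) → ℝ) :
    binAvg (insert e S) p q F = (1 - p) * binAvg S p q (fun s => F (Function.update s e 0)) +
      (p * (1 - q) * binAvg S p q (fun s => F (Function.update s e 1)) +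
      p * q * binAvg S p q (fun s => F (Function.update s e (-1)))) := by
  simp only [binAvg]
  rw [Finset.sum_powerset_insert he, Finset.mul_sum, Finset.mul_sum, Finset.mul_sum]
  conv_rhs => rw [← Finset.sum_add_distrib]
  congr 1 <;> refine Finset.sum_congr rfl fun E hE => ?_
  · have heE : e ∉ E := fun h => he (Finset.mem_powerset.1 hE h)
    rw [noiseAvg_update_zero heE, Finset.insert_sdiff_of_notMem _ heE,
      Finset.card_insert_of_notMem fun h => he (Finset.mem_sdiff.1 h).1]
    ring
  · have heE : e ∉ E := fun h => he (Finset.mem_powerset.1 hE h)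
    rw [noiseAvg_insert heE, Finset.insert_sdiff_insert, Finset.sdiff_insert_of_notMem he,
      Finset.card_insert_of_notMem heE]
    ring

/-- In the binomial model the answer at `e` is independent of the others: averaging over it first
does not change the average. -/
theorem binAvg_resample {p q : ℝ} {S : Finset β} {e : β} (he : e ∈ S) (F : ℝ → (β → ℝ) → ℝ)
    (hF : ∀ t s x, F t (Function.update s e x) = F t s) :
    binAvg S p q (fun s => F (s e) s) =
      binAvg S p q (fun s => (1 - p) * F 0 s + (p * (1 - q) * F 1 s + p * q * F (-1) s)) := by
  obtain ⟨S, he', rfl⟩ : ∃ S', e ∉ S' ∧ insert e S' = S :=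
    ⟨S.erase e, Finset.notMem_erase e S, Finset.insert_erase he⟩
  rw [binAvg_insert he', binAvg_insert he']
  simp only [Function.update_self, hF, binAvg_add, binAvg_const_mul]
  ring

/-! ### Comparison of the two models -/

/-- The average of a monomial in the answers over the errors. -/
theorem noiseAvg_monomial (q : ℝ) (E : Finset β) (d : β →₀ ℕ) :
    noiseAvg q E (fun s => ∏ e ∈ d.support, s e ^ d e) =
      if d.support ⊆ E then ∏ e ∈ d.support, (q * (-1) ^ d e + (1 - q)) else 0 := by
  split_ifs with h
  · have h2 : ∏ e ∈ d.support, (q * (-1) ^ d e + (1 - q)) =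
        ∏ e ∈ E, (q * (-1) ^ d e + (1 - q)) := by
      refine Finset.prod_subset h fun e _ he => ?_
      rw [Finsupp.notMem_support_iff.1 he]; ring
    rw [h2, Finset.prod_add, noiseAvg]
    refine Finset.sum_congr rfl fun X hX => ?_
    have hXE := Finset.mem_powerset.1 hX
    have h3 : ∏ e ∈ d.support, signs E X e ^ d e = ∏ e ∈ X, (-1 : ℝ) ^ d e := by
      have : ∏ e ∈ d.support, signs E X e ^ d e = ∏ e ∈ E, signs E X e ^ d e := by
        refine Finset.prod_subset h fun e _ he => ?_
        rw [Finsupp.notMem_support_iff.1 he, pow_zero]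
      rw [this, ← Finset.prod_subset hXE (f := fun e => signs E X e ^ d e)]
      · exact Finset.prod_congr rfl fun e he => by simp [signs, he, hXE he]
      · intro e he he'
        simp [signs, he, he']
    rw [h3, Finset.prod_mul_distrib, Finset.prod_const, Finset.prod_const]
    ring
  · obtain ⟨e, he, heE⟩ := Finset.not_subset.1 h
    refine Finset.sum_eq_zero fun X _ => ?_
    refine mul_eq_zero_of_right _ (Finset.prod_eq_zero he ?_)
    rw [signs, if_neg heE, zero_pow (Finsupp.mem_support_iff.1 he)]

theorem binAvg_monomial (p q : ℝ) {S : Finset β} {d : β →₀ ℕ} (hd : d.support ⊆ S) :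
    binAvg S p q (fun s => ∏ e ∈ d.support, s e ^ d e) =
      p ^ d.support.card * ∏ e ∈ d.support, (q * (-1) ^ d e + (1 - q)) := by
  have h1 : ∏ e ∈ S, (p + if e ∈ d.support then 0 else 1 - p) = p ^ d.support.card := by
    rw [← Finset.prod_const, ← Finset.prod_subset hd]
    · exact Finset.prod_congr rfl fun e he => by simp only [he, if_true, add_zero]
    · intro e _ he
      simp only [he, if_false]; ring
  rw [← h1, Finset.prod_add, Finset.sum_mul, binAvg]
  refine Finset.sum_congr rfl fun E hE => ?_
  rw [noiseAvg_monomial, Finset.prod_const]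
  split_ifs with h
  · rw [← Finset.prod_const (1 - p)]
    congr 2
    refine Finset.prod_congr rfl fun e he => ?_
    rw [if_neg fun h' => (Finset.mem_sdiff.1 he).2 (h h')]
  · obtain ⟨e, he, heE⟩ := Finset.not_subset.1 h
    rw [Finset.prod_eq_zero (i := e) (Finset.mem_sdiff.2 ⟨hd he, heE⟩) (by rw [if_pos he])]
    ring

theorem card_filter_subset_powersetCard {S K : Finset β} (hK : K ⊆ S) (m : ℕ) (hm : K.card ≤ m) :
    ((S.powersetCard m).filter (K ⊆ ·)).card = (S.card - K.card).choose (m - K.card) := by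
  rw [← Finset.card_sdiff_of_subset hK, ← Finset.card_powersetCard]
  symm
  refine Finset.card_bij (fun T _ => T ∪ K) ?_ ?_ ?_
  · intro T hT
    obtain ⟨h1, h2⟩ := Finset.mem_powersetCard.1 hT
    have hd : Disjoint T K := Finset.disjoint_of_subset_left h1 Finset.sdiff_disjoint
    rw [Finset.mem_filter, Finset.mem_powersetCard, Finset.card_union_of_disjoint hd]
    exact ⟨⟨Finset.union_subset (h1.trans Finset.sdiff_subset) hK, by omega⟩,
      Finset.subset_union_right⟩
  · intro T hT T' hT' h
    have hd : Disjoint T K := Finset.disjoint_of_subset_left (Finset.mem_powersetCard.1 hT).1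
      Finset.sdiff_disjoint
    have hd' : Disjoint T' K := Finset.disjoint_of_subset_left (Finset.mem_powersetCard.1 hT').1
      Finset.sdiff_disjoint
    rw [← Finset.union_sdiff_cancel_right hd, h, Finset.union_sdiff_cancel_right hd']
  · intro E hE
    obtain ⟨h1, h2⟩ := Finset.mem_filter.1 hE
    obtain ⟨h3, h4⟩ := Finset.mem_powersetCard.1 h1
    refine ⟨E \ K, Finset.mem_powersetCard.2 ⟨Finset.sdiff_subset_sdiff h3 le_rfl, ?_⟩,
      Finset.sdiff_union_of_subset h2⟩
    rw [Finset.card_sdiff_of_subset h2, h4]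

/-- The probability that a uniformly random set of `m` elements contains `K`. -/
noncomputable def inclProb (N m K : ℕ) : ℝ := m.descFactorial K / N.descFactorial K

theorem unifAvg_monomial (q : ℝ) {S : Finset β} {m : ℕ} (hm : m ≤ S.card) {d : β →₀ ℕ}
    (hd : d.support ⊆ S) :
    unifAvg S m q (fun s => ∏ e ∈ d.support, s e ^ d e) =
      inclProb S.card m d.support.card * ∏ e ∈ d.support, (q * (-1) ^ d e + (1 - q)) := by
  simp only [unifAvg, noiseAvg_monomial]
  rw [← Finset.mul_sum, ← Finset.sum_filter, Finset.sum_const, nsmul_eq_mul, ← mul_assoc]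
  congr 1
  set K := d.support.card with hKdef
  have hKS : K ≤ S.card := Finset.card_le_card hd
  have hc : (S.card.choose m : ℝ) ≠ 0 := by exact_mod_cast (Nat.choose_pos hm).ne'
  have hD : (S.card.descFactorial K : ℝ) ≠ 0 := by
    exact_mod_cast (Nat.descFactorial_pos.2 hKS).ne'
  rcases Nat.lt_or_ge m K with h | h
  · rw [inclProb, Nat.descFactorial_eq_zero_iff_lt.2 h, Finset.filter_false_of_mem]
    · simp
    · intro E hE hsub
      have := Finset.card_le_card hsub
      rw [(Finset.mem_powersetCard.1 hE).2] at this
      omega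
  · rw [card_filter_subset_powersetCard hd m h, inclProb]
    have h1 := Nat.choose_mul (n := S.card) h
    have h2 := Nat.descFactorial_eq_factorial_mul_choose m K
    have h3 := Nat.descFactorial_eq_factorial_mul_choose S.card K
    have h4 : ((S.card.choose m : ℕ) : ℝ) * m.choose K =
        S.card.choose K * (S.card - K).choose (m - K) := by exact_mod_cast h1
    rw [h3] at hD
    rw [h2, h3]
    push_cast at hD ⊢
    rw [mul_div_mul_left _ _ (left_ne_zero_of_mul hD), eq_div_iff (right_ne_zero_of_mul hD),
      inv_mul_eq_div, div_mul_eq_mul_div, div_eq_iff hc]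
    linarith

/-- Sampling without replacement makes it less likely to contain a given set. -/
theorem inclProb_le {N m : ℕ} (hm : m ≤ N) (hN : 0 < N) (K : ℕ) (hK : K ≤ N) :
    inclProb N m K ≤ ((m : ℝ) / N) ^ K := by
  have hD : (0 : ℝ) < N.descFactorial K := by exact_mod_cast (Nat.descFactorial_pos.2 hK)
  have key : ∀ K, m.descFactorial K * N ^ K ≤ m ^ K * N.descFactorial K := by
    intro K
    induction K with
    | zero => simp
    | succ K ih =>
      rw [Nat.descFactorial_succ, Nat.descFactorial_succ, pow_succ, pow_succ]
      have h : (m - K) * N ≤ m * (N - K) := by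
        rcases Nat.le_total m K with h | h
        · simp [Nat.sub_eq_zero_of_le h]
        · zify [h, h.trans hm]
          nlinarith
      calc (m - K) * m.descFactorial K * (N ^ K * N)
          = (m.descFactorial K * N ^ K) * ((m - K) * N) := by ring
        _ ≤ (m ^ K * N.descFactorial K) * (m * (N - K)) := Nat.mul_le_mul ih h
        _ = _ := by ring
  rw [inclProb, div_pow, div_le_div_iff₀ hD (by positivity)]
  exact_mod_cast key K

/-- Sets of size at most `J` are contained in a sample of `m ≫ J ^ 2` elements almost as often as
with independent choices. -/
theorem le_inclProb {N m J : ℕ} (hm : m ≤ N) (hm0 : 0 < m) (K : ℕ) (hK : K ≤ N) (hKJ : K ≤ J) :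
    (1 - (J : ℝ) ^ 2 / m) * ((m : ℝ) / N) ^ K ≤ inclProb N m K := by
  have hN : (0 : ℝ) < N := by exact_mod_cast hm0.trans_le hm
  have hm0' : (0 : ℝ) < m := by exact_mod_cast hm0
  have hD : (0 : ℝ) < N.descFactorial K := by exact_mod_cast (Nat.descFactorial_pos.2 hK)
  rcases le_or_gt m J with h | h
  · refine le_trans (mul_nonpos_of_nonpos_of_nonneg ?_ (by positivity)) (by
      unfold inclProb; positivity)
    rw [sub_nonpos, le_div_iff₀ hm0', one_mul]
    have : (m : ℝ) ≤ J := by exact_mod_cast h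
    have h1 : (1 : ℝ) ≤ m := by exact_mod_cast hm0
    nlinarith
  have h1 : ((m : ℝ) - K) ^ K ≤ m.descFactorial K := by
    refine le_trans (pow_le_pow_left₀ ?_ ?_ _)
      (by exact_mod_cast Nat.pow_sub_le_descFactorial m K : (((m + 1 - K : ℕ)) : ℝ) ^ K ≤ _)
    · rw [sub_nonneg]; exact_mod_cast (hKJ.trans h.le)
    · rw [sub_le_iff_le_add]; norm_cast; omega
  have h2 : (N.descFactorial K : ℝ) ≤ (N : ℝ) ^ K := by
    exact_mod_cast Nat.descFactorial_le_pow N K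
  have h3 : 1 - (J : ℝ) ^ 2 / m ≤ (1 - (K : ℝ) / m) ^ K := by
    have hb := one_add_mul_le_pow (a := -((K : ℝ) / m)) (by
      rw [neg_le_neg_iff, div_le_iff₀ hm0']
      have : (K : ℝ) ≤ m := by exact_mod_cast (hKJ.trans h.le)
      linarith) K
    rw [← sub_eq_add_neg] at hb
    refine le_trans ?_ hb
    have : (K : ℝ) * K / m ≤ (J : ℝ) ^ 2 / m := by
      gcongr
      have : (K : ℝ) ≤ J := by exact_mod_cast hKJ
      nlinarith [Nat.cast_nonneg (α := ℝ) K]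
    have e : (K : ℝ) * -((K : ℝ) / m) = -((K : ℝ) * K / m) := by ring
    rw [e]; linarith
  calc (1 - (J : ℝ) ^ 2 / m) * ((m : ℝ) / N) ^ K
      ≤ (1 - (K : ℝ) / m) ^ K * ((m : ℝ) / N) ^ K := by gcongr
    _ = ((m : ℝ) - K) ^ K / N ^ K := by
        rw [← mul_pow, ← div_pow]; congr 1; field_simp
    _ ≤ m.descFactorial K / N ^ K := by gcongr
    _ ≤ inclProb N m K := by
        unfold inclProb; gcongr

theorem aeval_eq_sum {γ : Type*} (P : MvPolynomial γ ℕ) (s : γ → ℝ) :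
    MvPolynomial.aeval s P = ∑ d ∈ P.support, ((P.coeff d : ℕ) : ℝ) * ∏ e ∈ d.support, s e ^ d e := by
  rw [MvPolynomial.aeval_def, MvPolynomial.eval₂_eq]
  simp

/-- The average of a monomial over the errors is nonnegative; this is why the comparison of the two
models respects inequalities. -/
theorem monomial_factor_nonneg {γ : Type*} {q : ℝ} (hq : q ≤ 1 / 2) (d : γ →₀ ℕ) :
    0 ≤ ∏ e ∈ d.support, (q * (-1) ^ d e + (1 - q)) := by
  refine Finset.prod_nonneg fun e _ => ?_
  rcases neg_one_pow_eq_or ℝ (d e) with h | h <;> rw [h] <;> linarith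

theorem noiseAvg_monomial_of_not_subset (q : ℝ) {S E : Finset β} (hE : E ⊆ S) {d : β →₀ ℕ}
    (hd : ¬d.support ⊆ S) : noiseAvg q E (fun s => ∏ e ∈ d.support, s e ^ d e) = 0 := by
  rw [noiseAvg_monomial, if_neg fun h => hd (h.trans hE)]

theorem binAvg_monomial_of_not_subset (p q : ℝ) {S : Finset β} {d : β →₀ ℕ}
    (hd : ¬d.support ⊆ S) : binAvg S p q (fun s => ∏ e ∈ d.support, s e ^ d e) = 0 :=
  Finset.sum_eq_zero fun E hE => by
    rw [noiseAvg_monomial_of_not_subset q (Finset.mem_powerset.1 hE) hd, mul_zero]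

theorem unifAvg_monomial_of_not_subset (q : ℝ) {S : Finset β} {m : ℕ} {d : β →₀ ℕ}
    (hd : ¬d.support ⊆ S) : unifAvg S m q (fun s => ∏ e ∈ d.support, s e ^ d e) = 0 :=
  Finset.sum_eq_zero fun E hE => by
    rw [noiseAvg_monomial_of_not_subset q (Finset.mem_powersetCard.1 hE).1 hd, mul_zero]

/-- The average of a polynomial with nonnegative coefficients is at most as large in the uniform
model as in the binomial model with the same density. -/
theorem unifAvg_poly_le {q : ℝ} (hq : q ≤ 1 / 2) {S : Finset β} {m : ℕ}
    (hm : m ≤ S.card) (hm0 : 0 < m) (P : MvPolynomial β ℕ) :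
    unifAvg S m q (fun s => MvPolynomial.aeval s P) ≤ binAvg S (m / S.card) q (fun s => MvPolynomial.aeval s P) := by
  simp only [aeval_eq_sum, unifAvg_sum, binAvg_sum, unifAvg_const_mul, binAvg_const_mul]
  refine Finset.sum_le_sum fun d _ => mul_le_mul_of_nonneg_left ?_ (Nat.cast_nonneg _)
  by_cases hd : d.support ⊆ S
  · rw [unifAvg_monomial q hm hd, binAvg_monomial _ q hd]
    exact mul_le_mul_of_nonneg_right (inclProb_le hm (by omega) _ (Finset.card_le_card hd))
      (monomial_factor_nonneg hq d)
  · rw [unifAvg_monomial_of_not_subset q hd, binAvg_monomial_of_not_subset _ q hd]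

/-- Conversely, the two averages are close if the degree is small. -/
theorem le_unifAvg_poly {q : ℝ} (hq : q ≤ 1 / 2) {S : Finset β} {m J : ℕ}
    (hm : m ≤ S.card) (hm0 : 0 < m) (P : MvPolynomial β ℕ) (hP : P.totalDegree ≤ J) :
    (1 - (J : ℝ) ^ 2 / m) * binAvg S (m / S.card) q (fun s => MvPolynomial.aeval s P) ≤
      unifAvg S m q (fun s => MvPolynomial.aeval s P) := by
  simp only [aeval_eq_sum, unifAvg_sum, binAvg_sum, unifAvg_const_mul, binAvg_const_mul]
  rw [Finset.mul_sum]
  refine Finset.sum_le_sum fun d hdP => ?_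
  rw [mul_left_comm]
  refine mul_le_mul_of_nonneg_left ?_ (Nat.cast_nonneg _)
  by_cases hd : d.support ⊆ S
  · rw [unifAvg_monomial q hm hd, binAvg_monomial _ q hd, ← mul_assoc]
    refine mul_le_mul_of_nonneg_right (le_inclProb hm hm0 _ (Finset.card_le_card hd) ?_)
      (monomial_factor_nonneg hq d)
    refine le_trans ?_ ((MvPolynomial.le_totalDegree hdP).trans hP)
    rw [Finsupp.sum, Finset.card_eq_sum_ones]
    exact Finset.sum_le_sum fun e he => Nat.one_le_iff_ne_zero.2 (Finsupp.mem_support_iff.1 he)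
  · rw [unifAvg_monomial_of_not_subset q hd, binAvg_monomial_of_not_subset _ q hd, mul_zero]

/-- The binomial coefficient at the mean of a binomial distribution is the largest. -/
theorem choose_mul_pow_le_mode {N m : ℕ} (hm : m ≤ N) (k : ℕ) (hk : k ≤ N) :
    N.choose k * m ^ k * (N - m) ^ (N - k) ≤ N.choose m * m ^ m * (N - m) ^ (N - m) := by
  have step : ∀ k < N, (N.choose (k + 1) * m ^ (k + 1) * (N - m) ^ (N - (k + 1))) *
      ((k + 1) * (N - m)) = (N.choose k * m ^ k * (N - m) ^ (N - k)) * ((N - k) * m) := by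
    intro k hk
    have h := Nat.choose_succ_right_eq N k
    have e : N - k = (N - (k + 1)) + 1 := by omega
    calc (N.choose (k + 1) * m ^ (k + 1) * (N - m) ^ (N - (k + 1))) * ((k + 1) * (N - m))
        = (N.choose (k + 1) * (k + 1)) * m ^ (k + 1) * (N - m) ^ ((N - (k + 1)) + 1) := by ring
      _ = _ := by rw [h, ← e]; ring
  rcases Nat.lt_or_ge m N with hmN | hmN
  swap
  · obtain rfl : m = N := le_antisymm hm hmN
    rcases Nat.lt_or_ge k m with h | h
    · simp [zero_pow (show m - k ≠ 0 by omega)]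
    · obtain rfl : k = m := le_antisymm hk h
      rfl
  rcases Nat.le_total k m with h | h
  · induction h using Nat.decreasingInduction with
    | self => rfl
    | of_succ k hkm ih =>
      refine le_trans ?_ (ih (by omega))
      have hs := step k (by omega)
      have hle : (k + 1) * (N - m) ≤ (N - k) * m := by
        zify [hm, show k ≤ N by omega]
        have : (k : ℤ) + 1 ≤ m := by exact_mod_cast hkm
        nlinarith
      have hpos : 0 < (k + 1) * (N - m) := Nat.mul_pos (by omega) (by omega)
      refine Nat.le_of_mul_le_mul_right ?_ hpos
      rw [hs]
      exact Nat.mul_le_mul_left _ hle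
  · induction k, h using Nat.le_induction with
    | base => rfl
    | succ k hkm ih =>
      refine le_trans ?_ (ih (by omega))
      have hs := step k (by omega)
      have hle : (N - k) * m ≤ (k + 1) * (N - m) := by
        zify [hm, show k ≤ N by omega]
        have : (m : ℤ) ≤ k := by exact_mod_cast hkm
        have : (m : ℤ) ≤ N := by exact_mod_cast hm
        nlinarith
      have hpos : 0 < (k + 1) * (N - m) := Nat.mul_pos (by omega) (by omega)
      refine Nat.le_of_mul_le_mul_right ?_ hpos
      rw [hs]
      exact Nat.mul_le_mul_left _ hle

/-- The average of a nonnegative function in the uniform model exceeds that in the binomial model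
at most by a factor of `N + 1`: the number of queries in the binomial model takes its most likely
value `m` with probability at least `1 / (N + 1)`. -/
theorem unifAvg_le_binAvg {q : ℝ} (hq0 : 0 ≤ q) (hq : q ≤ 1) {S : Finset β} {m : ℕ}
    (hm : m ≤ S.card) (hm0 : 0 < m) {F : (β → ℝ) → ℝ} (hF : ∀ s, 0 ≤ F s) :
    unifAvg S m q F ≤ (S.card + 1) * binAvg S (m / S.card) q F := by
  set N := S.card with hN
  have hN0 : (0 : ℝ) < N := by exact_mod_cast hm0.trans_le hm
  have hC : (0 : ℝ) < N.choose m := by exact_mod_cast Nat.choose_pos hm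
  set p : ℝ := m / N with hp
  have hp0 : 0 ≤ p := by positivity
  have hp1 : p ≤ 1 := by rw [hp, div_le_one hN0]; exact_mod_cast hm
  have hpq : 1 - p = ((N - m : ℕ) : ℝ) / N := by
    rw [hp, Nat.cast_sub hm]; field_simp
  have hterm : ∀ k ≤ N, (N.choose k : ℝ) * p ^ k * (1 - p) ^ (N - k) =
      ((N.choose k * m ^ k * (N - m) ^ (N - k) : ℕ) : ℝ) / N ^ N := by
    intro k hk
    rw [hpq, hp, div_pow, div_pow]
    push_cast
    have e : (N : ℝ) ^ N = N ^ k * N ^ (N - k) := by rw [← pow_add]; congr 1; omega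
    rw [e]
    field_simp
  have hmode : 1 ≤ ((N : ℝ) + 1) * (N.choose m * p ^ m * (1 - p) ^ (N - m)) := by
    have h1 : ∑ k ∈ Finset.range (N + 1), (N.choose k : ℝ) * p ^ k * (1 - p) ^ (N - k) = 1 := by
      have := add_pow p (1 - p) N
      rw [add_sub_cancel, one_pow] at this
      exact (Finset.sum_congr rfl fun k _ => by ring).trans this.symm
    have h2 : ∑ k ∈ Finset.range (N + 1), (N.choose k : ℝ) * p ^ k * (1 - p) ^ (N - k) ≤
        ∑ _k ∈ Finset.range (N + 1), (N.choose m : ℝ) * p ^ m * (1 - p) ^ (N - m) := by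
      refine Finset.sum_le_sum fun k hk => ?_
      have hk' : k ≤ N := by simpa [Nat.lt_succ_iff] using hk
      rw [hterm k hk', hterm m hm]
      exact div_le_div_of_nonneg_right (by exact_mod_cast choose_mul_pow_le_mode hm k hk')
        (by positivity)
    rw [h1] at h2
    simpa using h2
  have hterm0 : ∀ E ∈ S.powersetCard m, ((N.choose m : ℕ) : ℝ)⁻¹ * noiseAvg q E F ≤
      ((N : ℝ) + 1) * (p ^ E.card * (1 - p) ^ (S \ E).card * noiseAvg q E F) := by
    intro E hE
    obtain ⟨h1, h2⟩ := Finset.mem_powersetCard.1 hE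
    rw [Finset.card_sdiff_of_subset h1, h2, ← mul_assoc]
    refine mul_le_mul_of_nonneg_right ?_ (noiseAvg_nonneg hq0 hq hF)
    rw [inv_le_iff_one_le_mul₀ hC]
    calc (1 : ℝ) ≤ _ := hmode
      _ = _ := by ring
  calc unifAvg S m q F ≤ ∑ E ∈ S.powersetCard m,
        ((N : ℝ) + 1) * (p ^ E.card * (1 - p) ^ (S \ E).card * noiseAvg q E F) :=
        Finset.sum_le_sum hterm0
    _ ≤ ∑ E ∈ S.powerset,
        ((N : ℝ) + 1) * (p ^ E.card * (1 - p) ^ (S \ E).card * noiseAvg q E F) := by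
        refine Finset.sum_le_sum_of_subset_of_nonneg (fun E hE => ?_) fun E _ _ => ?_
        · exact Finset.mem_powerset.2 (Finset.mem_powersetCard.1 hE).1
        · exact mul_nonneg (by positivity) (mul_nonneg (mul_nonneg (pow_nonneg hp0 _)
            (pow_nonneg (by linarith) _)) (noiseAvg_nonneg hq0 hq hF))
    _ = _ := by rw [← Finset.mul_sum]; rfl

end Averages

/-! ### Signed path counts through the layers -/

section Paths

variable {V : Type*} [Fintype V] [DecidableEq V]

/-- The items of layer `j`. -/
def layerSet (lay : V → ℕ) (j : ℕ) : Finset V := Finset.univ.filter fun v => lay v = j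

theorem mem_layerSet {V : Type*} [Fintype V] {lay : V → ℕ} {j : ℕ} {v : V} : v ∈ layerSet lay j ↔ lay v = j := by
  simp [layerSet]

/-- The sum, over all paths from `r` to `v` through the layers `0, …, j - 1`, of the monomials that
multiply the answers along the path. -/
noncomputable def pathPoly (lay : V → ℕ) (r : V) : ℕ → V → MvPolynomial (Sym2 V) ℕ
  | 0, v => if v = r then 1 else 0
  | j + 1, v => ∑ u ∈ layerSet lay j, MvPolynomial.X s(u, v) * pathPoly lay r j u

/-- The value of `pathPoly` at the answers `s`: a signed count of paths. -/
noncomputable def pathVal (lay : V → ℕ) (r : V) (s : Sym2 V → ℝ) (j : ℕ) (v : V) : ℝ :=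
  MvPolynomial.aeval s (pathPoly lay r j v)

variable {lay : V → ℕ} {r : V}

theorem pathVal_zero (s : Sym2 V → ℝ) (v : V) :
    pathVal lay r s 0 v = if v = r then 1 else 0 := by
  rw [pathVal, pathPoly]; split_ifs <;> simp

theorem pathVal_succ (s : Sym2 V → ℝ) (j : ℕ) (v : V) :
    pathVal lay r s (j + 1) v = ∑ u ∈ layerSet lay j, s s(u, v) * pathVal lay r s j u := by
  simp [pathVal, pathPoly, map_sum]

theorem totalDegree_pathPoly_le (j : ℕ) (v : V) : (pathPoly lay r j v).totalDegree ≤ j := by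
  induction j generalizing v with
  | zero => rw [pathPoly]; split_ifs <;> simp
  | succ j ih =>
    rw [pathPoly]
    refine MvPolynomial.totalDegree_finsetSum_le fun u _ => ?_
    refine (MvPolynomial.totalDegree_mul _ _).trans ?_
    rw [MvPolynomial.totalDegree_X]
    have := ih u
    omega

/-- The path counts up to layer `j` do not involve the pairs between the layers `j` and `j + 1`. -/
theorem pathVal_update {j : ℕ} {u v : V} (hu : lay u = j) (hv : lay v = j + 1) (s : Sym2 V → ℝ)
    (x : ℝ) {i : ℕ} (hi : i ≤ j) {w : V} (hw : lay w = i) :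
    pathVal lay r (Function.update s s(u, v) x) i w = pathVal lay r s i w := by
  induction i generalizing w with
  | zero => simp only [pathVal_zero]
  | succ i ih =>
    rw [pathVal_succ, pathVal_succ]
    refine Finset.sum_congr rfl fun u' hu' => ?_
    rw [mem_layerSet] at hu'
    rw [ih (by omega) hu', Function.update_of_ne]
    intro h
    rcases Sym2.eq_iff.1 h with ⟨rfl, rfl⟩ | ⟨rfl, rfl⟩ <;> omega

/-! ### First and second moments in the binomial model -/

theorem binAvg_coord_mul {β : Type*} [DecidableEq β] {S : Finset β} {p q : ℝ} {e : β} (he : e ∈ S)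
    {G : (β → ℝ) → ℝ} (hG : ∀ s x, G (Function.update s e x) = G s) :
    binAvg S p q (fun s => s e * G s) = p * (1 - 2 * q) * binAvg S p q G := by
  rw [binAvg_resample he (fun t s => t * G s) fun t s x => by rw [hG], ← binAvg_const_mul]
  congr 1
  ext s
  ring

theorem binAvg_coord_sq_mul {β : Type*} [DecidableEq β] {S : Finset β} {p q : ℝ} {e : β}
    (he : e ∈ S) {G : (β → ℝ) → ℝ} (hG : ∀ s x, G (Function.update s e x) = G s) :
    binAvg S p q (fun s => s e ^ 2 * G s) = p * binAvg S p q G := by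
  rw [binAvg_resample he (fun t s => t ^ 2 * G s) fun t s x => by rw [hG], ← binAvg_const_mul]
  congr 1
  ext s
  ring

theorem binAvg_coord_mul_coord_mul {β : Type*} [DecidableEq β] {S : Finset β} {p q : ℝ} {e e' : β}
    (he : e ∈ S) (he' : e' ∈ S) (hne : e' ≠ e) {G : (β → ℝ) → ℝ}
    (hG : ∀ s x, G (Function.update s e x) = G s) (hG' : ∀ s x, G (Function.update s e' x) = G s) :
    binAvg S p q (fun s => s e * (s e' * G s)) = (p * (1 - 2 * q)) ^ 2 * binAvg S p q G := by
  rw [binAvg_coord_mul he (G := fun s => s e' * G s), binAvg_coord_mul he' hG']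
  · ring
  · intro s x
    rw [hG, Function.update_of_ne hne]

variable {S : Finset (Sym2 V)} {p q : ℝ}

/-- The second moment of the total path count of layer `j`. -/
noncomputable def totalMoment (lay : V → ℕ) (r : V) (S : Finset (Sym2 V)) (p q : ℝ) (j : ℕ) : ℝ :=
  binAvg S p q fun s => (∑ u ∈ layerSet lay j, pathVal lay r s j u) ^ 2

/-- The sum of the second moments of the path counts of layer `j`. -/
noncomputable def sumMoment (lay : V → ℕ) (r : V) (S : Finset (Sym2 V)) (p q : ℝ) (j : ℕ) : ℝ :=
  binAvg S p q fun s => ∑ u ∈ layerSet lay j, pathVal lay r s j u ^ 2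

/-- The mean of the total path count of layer `j`. -/
noncomputable def totalMean (lay : V → ℕ) (r : V) (S : Finset (Sym2 V)) (p q : ℝ) (j : ℕ) : ℝ :=
  binAvg S p q fun s => ∑ u ∈ layerSet lay j, pathVal lay r s j u

theorem binAvg_pathVal_succ (hS : ∀ u v : V, u ≠ v → s(u, v) ∈ S) {j : ℕ} {v : V}
    (hv : lay v = j + 1) :
    binAvg S p q (fun s => pathVal lay r s (j + 1) v) =
      p * (1 - 2 * q) * totalMean lay r S p q j := by
  simp only [pathVal_succ, binAvg_sum, totalMean, Finset.mul_sum]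
  refine Finset.sum_congr rfl fun u hu => ?_
  rw [mem_layerSet] at hu
  exact binAvg_coord_mul (hS _ _ (by rintro rfl; omega)) fun s x => pathVal_update hu hv s x le_rfl hu

/-- Different items of layer `j + 1` are reached through different pairs, which are independent. -/
theorem binAvg_pathVal_mul (hS : ∀ u v : V, u ≠ v → s(u, v) ∈ S) {j : ℕ} {v v' : V}
    (hv : lay v = j + 1) (hv' : lay v' = j + 1) (hne : v ≠ v') :
    binAvg S p q (fun s => pathVal lay r s (j + 1) v * pathVal lay r s (j + 1) v') =
      (p * (1 - 2 * q)) ^ 2 * totalMoment lay r S p q j := by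
  simp only [pathVal_succ, totalMoment, sq (∑ u ∈ _, _), Finset.sum_mul_sum, binAvg_sum]
  rw [Finset.mul_sum]
  refine Finset.sum_congr rfl fun u hu => ?_
  rw [Finset.mul_sum]
  refine Finset.sum_congr rfl fun u' hu' => ?_
  rw [mem_layerSet] at hu hu'
  rw [← binAvg_coord_mul_coord_mul (e := s(u, v)) (e' := s(u', v'))
    (hS _ _ (by rintro rfl; omega)) (hS _ _ (by rintro rfl; omega))]
  · congr 1; ext s; ring
  · intro h
    rcases Sym2.eq_iff.1 h with ⟨rfl, rfl⟩ | ⟨rfl, rfl⟩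
    · exact hne rfl
    · omega
  · intro s x
    rw [pathVal_update hu hv s x le_rfl hu, pathVal_update hu hv s x le_rfl hu']
  · intro s x
    rw [pathVal_update hu' hv' s x le_rfl hu, pathVal_update hu' hv' s x le_rfl hu']

/-- Paths that reach `v` through the same item of layer `j` share their last answer, whose square
has mean `p` instead of `(p * (1 - 2 * q)) ^ 2`; this is the second summand. -/
theorem binAvg_pathVal_sq_le (hS : ∀ u v : V, u ≠ v → s(u, v) ∈ S) (hp : 0 ≤ p) (hp1 : p ≤ 1)
    (hq : 0 ≤ q) (hq1 : q ≤ 1) {j : ℕ} {v : V} (hv : lay v = j + 1) :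
    binAvg S p q (fun s => pathVal lay r s (j + 1) v ^ 2) ≤
      (p * (1 - 2 * q)) ^ 2 * totalMoment lay r S p q j + p * sumMoment lay r S p q j := by
  have hterm : ∀ u ∈ layerSet lay j, ∀ u' ∈ layerSet lay j,
      binAvg S p q (fun s => s s(u, v) * pathVal lay r s j u *
        (s s(u', v) * pathVal lay r s j u')) ≤
      (p * (1 - 2 * q)) ^ 2 * binAvg S p q (fun s => pathVal lay r s j u * pathVal lay r s j u') +
        if u = u' then p * binAvg S p q (fun s => pathVal lay r s j u ^ 2) else 0 := by
    intro u hu u' hu'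
    rw [mem_layerSet] at hu hu'
    have huv : s(u, v) ∈ S := hS _ _ (by rintro rfl; omega)
    have huv' : s(u', v) ∈ S := hS _ _ (by rintro rfl; omega)
    split_ifs with h
    · subst h
      have h1 : binAvg S p q (fun s => s s(u, v) * pathVal lay r s j u *
          (s s(u, v) * pathVal lay r s j u)) =
          p * binAvg S p q (fun s => pathVal lay r s j u ^ 2) := by
        rw [← binAvg_coord_sq_mul huv]
        · congr 1; ext s; ring
        · intro s x
          rw [pathVal_update hu hv s x le_rfl hu]
      rw [h1]
      refine le_add_of_nonneg_left (mul_nonneg (sq_nonneg _) ?_)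
      exact binAvg_nonneg hp hp1 hq hq1 fun s => mul_self_nonneg _
    · rw [add_zero, ← binAvg_coord_mul_coord_mul (e := s(u, v)) (e' := s(u', v)) huv huv']
      · refine le_of_eq ?_
        congr 1; ext s; ring
      · intro h'
        rcases Sym2.eq_iff.1 h' with ⟨rfl, -⟩ | ⟨rfl, rfl⟩
        · exact h rfl
        · exact h rfl
      · intro s x
        rw [pathVal_update hu hv s x le_rfl hu, pathVal_update hu hv s x le_rfl hu']
      · intro s x
        rw [pathVal_update hu' hv s x le_rfl hu, pathVal_update hu' hv s x le_rfl hu']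
  simp only [pathVal_succ, totalMoment, sumMoment, sq (∑ u ∈ _, _), Finset.sum_mul_sum, binAvg_sum]
  refine (Finset.sum_le_sum fun u hu => Finset.sum_le_sum fun u' hu' => hterm u hu u' hu').trans ?_
  simp only [Finset.sum_add_distrib, Finset.sum_ite_eq, Finset.mul_sum]
  refine add_le_add_right (le_of_eq ?_) _
  exact Finset.sum_congr rfl fun u hu => if_pos hu

theorem totalMean_succ (hS : ∀ u v : V, u ≠ v → s(u, v) ∈ S) (j : ℕ) :
    totalMean lay r S p q (j + 1) =
      (layerSet lay (j + 1)).card * (p * (1 - 2 * q)) * totalMean lay r S p q j := by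
  rw [totalMean, binAvg_sum, Finset.sum_congr rfl fun v hv =>
    binAvg_pathVal_succ hS (mem_layerSet.1 hv), Finset.sum_const, nsmul_eq_mul]
  ring

theorem sumMoment_succ_le (hS : ∀ u v : V, u ≠ v → s(u, v) ∈ S) (hp : 0 ≤ p) (hp1 : p ≤ 1)
    (hq : 0 ≤ q) (hq1 : q ≤ 1) (j : ℕ) :
    sumMoment lay r S p q (j + 1) ≤ (layerSet lay (j + 1)).card *
      ((p * (1 - 2 * q)) ^ 2 * totalMoment lay r S p q j + p * sumMoment lay r S p q j) := by
  rw [sumMoment, binAvg_sum, ← nsmul_eq_mul, ← Finset.sum_const]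
  exact Finset.sum_le_sum fun v hv => binAvg_pathVal_sq_le hS hp hp1 hq hq1 (mem_layerSet.1 hv)

theorem totalMoment_succ_le (hS : ∀ u v : V, u ≠ v → s(u, v) ∈ S) (hp : 0 ≤ p) (hp1 : p ≤ 1)
    (hq : 0 ≤ q) (hq1 : q ≤ 1) (j : ℕ) :
    totalMoment lay r S p q (j + 1) ≤
      ((layerSet lay (j + 1)).card * (p * (1 - 2 * q))) ^ 2 * totalMoment lay r S p q j +
        (layerSet lay (j + 1)).card * (p * sumMoment lay r S p q j) := by
  have hS0 : 0 ≤ sumMoment lay r S p q j :=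
    binAvg_nonneg hp hp1 hq hq1 fun s => Finset.sum_nonneg fun _ _ => sq_nonneg _
  have hterm : ∀ v ∈ layerSet lay (j + 1), ∀ v' ∈ layerSet lay (j + 1),
      binAvg S p q (fun s => pathVal lay r s (j + 1) v * pathVal lay r s (j + 1) v') ≤
      (p * (1 - 2 * q)) ^ 2 * totalMoment lay r S p q j +
        if v = v' then p * sumMoment lay r S p q j else 0 := by
    intro v hv v' hv'
    rw [mem_layerSet] at hv hv'
    split_ifs with h
    · subst h
      simp only [← sq]
      exact binAvg_pathVal_sq_le hS hp hp1 hq hq1 hv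
    · rw [binAvg_pathVal_mul hS hv hv' h, add_zero]
  rw [totalMoment]
  simp only [sq (∑ u ∈ _, _), Finset.sum_mul_sum, binAvg_sum]
  refine (Finset.sum_le_sum fun u hu => Finset.sum_le_sum fun u' hu' => hterm u hu u' hu').trans ?_
  simp only [Finset.sum_add_distrib, Finset.sum_ite_eq, Finset.sum_const, nsmul_eq_mul]
  rw [Finset.sum_congr rfl fun u hu => if_pos hu, Finset.sum_const, nsmul_eq_mul]
  refine le_of_eq ?_
  ring

theorem moments_zero (hr : lay r = 0) : totalMean lay r S p q 0 = 1 ∧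
    totalMoment lay r S p q 0 = 1 ∧ sumMoment lay r S p q 0 = 1 := by
  have hr' : r ∈ layerSet lay 0 := mem_layerSet.2 hr
  simp [totalMean, totalMoment, sumMoment, pathVal_zero, hr', binAvg_one, ite_pow]

end Paths

/-- The recursion for the normalized second moments `t j` of the total path counts and `s j` of the
single path counts. The layers `1` and `k + 2` are large (size at least `a`), so that the errors
made there are negligible; each of the `k` layers in between shrinks `s` by a factor `4`, in total
by `4 ^ k ≥ a`, up to new contributions of size `k / a`. The bound has `s (k + 2) / θ` in it, which is
why `s` has to become so small. -/
theorem moment_recursion {t s N : ℕ → ℝ} {θ a K : ℝ} {k : ℕ} (hk : 1 ≤ k)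
    (ht0 : t 0 = 1) (hs0 : s 0 = 1) (hs : ∀ j, 0 ≤ s j)
    (hts : ∀ j ≤ k + 1, t (j + 1) ≤ t j + s j / (N (j + 1) * θ))
    (hss : ∀ j ≤ k + 1, s (j + 1) ≤ t j / N (j + 1) + s j / (N (j + 1) * θ))
    (hθ0 : 0 < θ) (hθ : θ ≤ 1) (ha0 : 0 < a) (hK : K = a * θ) (hKk : 4 * k ≤ K)
    (hak : a ≤ 4 ^ k) (hN1 : a ≤ N 1) (hN2 : a ≤ N (k + 2))
    (hN : ∀ j, 2 ≤ j → j ≤ k + 1 → a / k ≤ N j)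
    (hsmall : 3 / K + 2 * (k + 1) * k / a ≤ 1) :
    t (k + 2) + s (k + 2) / θ ≤ 1 + (8 / K + 2 * (k + 1) * k / a) := by
  have hk0 : (0 : ℝ) < k := by exact_mod_cast hk
  have hk1 : (1 : ℝ) ≤ k := by exact_mod_cast hk
  have hK4 : 4 ≤ K := by linarith
  have hK0 : 0 < K := by linarith
  have hKa : K ≤ a := by rw [hK]; nlinarith
  have hak' : a / k ≤ a := div_le_self ha0.le hk1
  have hNall : ∀ j, 2 ≤ j → j ≤ k + 2 → a / k ≤ N j := by
    intro j h1 h2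
    rcases Nat.lt_or_ge j (k + 2) with h | h
    · exact hN j h1 (by omega)
    · rw [show j = k + 2 by omega]; exact hak'.trans hN2
  have hκ : ∀ j, 2 ≤ j → j ≤ k + 2 → 4 ≤ N j * θ := by
    intro j h1 h2
    calc (4 : ℝ) ≤ K / k := by rw [le_div_iff₀ hk0]; exact hKk
      _ = a / k * θ := by rw [hK]; ring
      _ ≤ N j * θ := by gcongr; exact hNall j h1 h2
  have hak0 : 0 < a / k := by positivity
  have hdiv1 : 1 / N 1 ≤ 1 / K := by gcongr; linarith
  have hdiv2 : 1 / (N 1 * θ) ≤ 1 / K := by rw [hK]; gcongr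
  have ht1 : t 1 ≤ 1 + 1 / K := by
    have := hts 0 (by omega)
    rw [ht0, hs0] at this
    simp only [zero_add] at this
    linarith
  have hs1 : s 1 ≤ 2 / K := by
    have := hss 0 (by omega)
    rw [ht0, hs0] at this
    simp only [zero_add] at this
    have e : 2 / K = 1 / K + 1 / K := by ring
    linarith
  have hku : ∀ j, 1 ≤ j → j ≤ k + 2 → t j + s j ≤ 1 + 3 / K + 2 * ((j : ℝ) - 1) * k / a := by
    intro j hj
    induction j, hj using Nat.le_induction with
    | base =>
      intro _
      have e : 3 / K = 1 / K + 2 / K := by ring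
      simp only [Nat.cast_one, sub_self, mul_zero, zero_mul, zero_div]
      linarith
    | succ j hj ih =>
      intro hjk
      have ih' := ih (by omega)
      have hj1 : (1 : ℝ) ≤ j := by exact_mod_cast hj
      have hjk' : (j : ℝ) ≤ k + 1 := by
        have : j ≤ k + 1 := by omega
        exact_mod_cast this
      have hle1 : 2 * ((j : ℝ) - 1) * k / a ≤ 2 * (k + 1) * k / a := by gcongr; linarith
      have htj : t j ≤ 2 := by linarith [hs j]
      have h4 := hκ (j + 1) (by omega) hjk
      have hN' := hNall (j + 1) (by omega) hjk
      have d1 : s j / (N (j + 1) * θ) ≤ s j / 4 := div_le_div_of_nonneg_left (hs j) (by norm_num) h4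
      have d2 : t j / N (j + 1) ≤ 2 / (a / k) := div_le_div₀ (by norm_num) htj hak0 hN'
      have e : 2 * (((j + 1 : ℕ) : ℝ) - 1) * k / a = 2 * ((j : ℝ) - 1) * k / a + 2 / (a / k) := by
        push_cast; field_simp; ring
      rw [e]
      linarith [hts j (by omega), hss j (by omega), hs j]
  have ht2 : ∀ j, 1 ≤ j → j ≤ k + 2 → t j ≤ 2 := by
    intro j h1 h2
    have := hku j h1 h2
    have hjk' : (j : ℝ) - 1 ≤ k + 1 := by
      have : (j : ℝ) ≤ k + 2 := by exact_mod_cast h2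
      linarith
    have hle1 : 2 * ((j : ℝ) - 1) * k / a ≤ 2 * (k + 1) * k / a := by gcongr
    linarith [hs j]
  have hsj : ∀ i, i ≤ k → s (i + 1) ≤ 2 / K / 4 ^ i + 3 * (k / a) := by
    intro i
    induction i with
    | zero => intro _; simp only [zero_add, pow_zero, div_one]; have : 0 ≤ 3 * (k / a) := by positivity
              linarith
    | succ i ih =>
      intro hik
      have ih' := ih (by omega)
      have h4 := hκ (i + 1 + 1) (by omega) (by omega)
      have hN' := hNall (i + 1 + 1) (by omega) (by omega)
      have d1 : s (i + 1) / (N (i + 1 + 1) * θ) ≤ s (i + 1) / 4 :=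
        div_le_div_of_nonneg_left (hs _) (by norm_num) h4
      have d2 : t (i + 1) / N (i + 1 + 1) ≤ 2 / (a / k) :=
        div_le_div₀ (by norm_num) (ht2 _ (by omega) (by omega)) hak0 hN'
      have e : 2 / (a / k) = 2 * (k / a) := by field_simp
      have e2 : 2 / K / 4 ^ (i + 1) = (2 / K / 4 ^ i) / 4 := by rw [pow_succ]; field_simp
      have e3 : 0 ≤ k / a := by positivity
      rw [e2]
      linarith [hss (i + 1) (by omega)]
  have hA := hku (k + 2) (by omega) le_rfl
  have e1 : 2 * (((k + 2 : ℕ) : ℝ) - 1) * k / a = 2 * (k + 1) * k / a := by push_cast; ring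
  rw [e1] at hA
  have hsk := hsj k le_rfl
  have hsk' : s (k + 1) ≤ (2 / K + 3 * k) / a := by
    have : 2 / K / 4 ^ k ≤ 2 / K / a := by gcongr
    have e : (2 / K + 3 * k) / a = 2 / K / a + 3 * (k / a) := by ring
    linarith
  have hlast : s (k + 2) ≤ 2 / a + (2 / K + 3 * k) / a / K := by
    have d1 : s (k + 1) / (N (k + 1 + 1) * θ) ≤ (2 / K + 3 * k) / a / K := by
      refine div_le_div₀ (by positivity) hsk' hK0 ?_
      rw [hK]; gcongr
    have d2 : t (k + 1) / N (k + 1 + 1) ≤ 2 / a :=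
      div_le_div₀ (by norm_num) (ht2 _ (by omega) (by omega)) ha0 hN2
    linarith [hss (k + 1) le_rfl]
  have hfin : s (k + 2) / θ ≤ 5 / K := by
    have hθ' : θ = K / a := by rw [hK]; field_simp
    rw [div_le_iff₀ hθ0]
    refine hlast.trans ?_
    rw [hθ']
    have e : 5 / K * (K / a) = 2 / a + 3 / a := by field_simp; norm_num
    rw [e]
    have : (2 / K + 3 * k) / a / K ≤ 3 / a := by
      rw [div_right_comm]
      gcongr
      rw [div_le_iff₀ hK0]
      have : 2 / K ≤ 1 := by rw [div_le_one hK0]; linarith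
      linarith
    linarith
  have e8 : 8 / K = 3 / K + 5 / K := by ring
  linarith [hs (k + 2)]

/-! ### Most path counts are positive -/

section WeakRecovery

variable {V : Type*} [Fintype V] [DecidableEq V] {lay : V → ℕ} {r : V} {S : Finset (Sym2 V)}

/-- Layer `0` contains the starting point `r`, the layers `1` and `k + 2` have at least `a` items, and
each of the `k` layers in between has at least `a / k` items, where `a` is at most `4 ^ k`. Nothing is
asked of the layers from `k + 3` on. -/
structure LayerSizes (lay : V → ℕ) (r : V) (k : ℕ) (a : ℝ) : Prop where
  root : lay r = 0
  one_le : 1 ≤ k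
  pos : 0 < a
  le_pow : a ≤ 4 ^ k
  big : ∀ j, j = 1 ∨ j = k + 2 → a ≤ (layerSet lay j).card
  mid : ∀ j, 2 ≤ j → j ≤ k + 1 → a / k ≤ (layerSet lay j).card

/-- In the binomial model the path counts of layer `k + 3` are concentrated around their common
positive mean. -/
theorem binAvg_pathVal_concentrated (hS : ∀ u v : V, u ≠ v → s(u, v) ∈ S) {p q a : ℝ} {k : ℕ}
    (hp : 0 < p) (hp1 : p ≤ 1) (hq : 0 ≤ q) (hq1 : q < 1 / 2) (hL : LayerSizes lay r k a)
    (hK : 4 * k ≤ a * (p * (1 - 2 * q) ^ 2))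
    (hsmall : 3 / (a * (p * (1 - 2 * q) ^ 2)) + 2 * (k + 1) * k / a ≤ 1) :
    ∃ μ : ℝ, 0 < μ ∧ ∀ w, lay w = k + 3 →
      binAvg S p q (fun s => pathVal lay r s (k + 3) w) = μ ∧
      binAvg S p q (fun s => pathVal lay r s (k + 3) w ^ 2) ≤
        (1 + (8 / (a * (p * (1 - 2 * q) ^ 2)) + 2 * (k + 1) * k / a)) * μ ^ 2 := by
  have hq1' : q ≤ 1 := by linarith
  set δ := 1 - 2 * q with hδ
  have hδ0 : 0 < δ := by linarith
  have hδ1 : δ ≤ 1 := by linarith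
  obtain ⟨z1, z2, z3⟩ := moments_zero (S := S) (p := p) (q := q) hL.root
  have hk0 : (0 : ℝ) < k := by exact_mod_cast hL.one_le
  have hN : ∀ j, j ≤ k + 1 → (0 : ℝ) < (layerSet lay (j + 1)).card := by
    intro j hj
    rcases Nat.eq_zero_or_pos j with rfl | h
    · exact hL.pos.trans_le (hL.big _ (Or.inl rfl))
    · rcases Nat.lt_or_ge j (k + 1) with h' | h'
      · exact (div_pos hL.pos hk0).trans_le (hL.mid _ (by omega) (by omega))
      · exact hL.pos.trans_le (hL.big _ (Or.inr (by omega)))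
  have hμ : ∀ j, j ≤ k + 2 → 0 < totalMean lay r S p q j := by
    intro j
    induction j with
    | zero => intro _; rw [z1]; norm_num
    | succ j ih =>
      intro hj
      rw [totalMean_succ hS]
      exact mul_pos (mul_pos (hN j (by omega)) (mul_pos hp hδ0)) (ih (by omega))
  have hT0 : ∀ j, 0 ≤ sumMoment lay r S p q j := fun j =>
    binAvg_nonneg hp.le hp1 hq hq1' fun s => Finset.sum_nonneg fun _ _ => sq_nonneg _
  have key := moment_recursion (t := fun j => totalMoment lay r S p q j / totalMean lay r S p q j ^ 2)
    (s := fun j => sumMoment lay r S p q j / totalMean lay r S p q j ^ 2)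
    (N := fun j => (layerSet lay j).card) (θ := p * δ ^ 2) (a := a) (k := k) hL.one_le
    (by simp [z1, z2]) (by simp [z1, z3]) (fun j => div_nonneg (hT0 j) (sq_nonneg _))
    ?_ ?_ (by positivity) ?_ hL.pos rfl hK hL.le_pow (hL.big _ (Or.inl rfl))
    (hL.big _ (Or.inr rfl)) hL.mid hsmall
  · have hμ2 := hμ (k + 2) le_rfl
    refine ⟨p * δ * totalMean lay r S p q (k + 2), by positivity, fun w hw => ⟨?_, ?_⟩⟩
    · exact binAvg_pathVal_succ hS hw
    · refine (binAvg_pathVal_sq_le hS hp.le hp1 hq hq1' hw).trans ?_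
      rw [← hδ]
      have e : (p * δ) ^ 2 * totalMoment lay r S p q (k + 2) + p * sumMoment lay r S p q (k + 2) =
          (totalMoment lay r S p q (k + 2) / totalMean lay r S p q (k + 2) ^ 2 +
            sumMoment lay r S p q (k + 2) / totalMean lay r S p q (k + 2) ^ 2 / (p * δ ^ 2)) *
            (p * δ * totalMean lay r S p q (k + 2)) ^ 2 := by
        field_simp
      rw [e]
      exact mul_le_mul_of_nonneg_right key (sq_nonneg _)
  · intro j hj
    have hμj := hμ j (by omega)
    have hNj := hN j hj
    rw [totalMean_succ hS]
    refine (div_le_div_of_nonneg_right (totalMoment_succ_le hS hp.le hp1 hq hq1' j)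
      (sq_nonneg _)).trans (le_of_eq ?_)
    rw [← hδ]
    field_simp
  · intro j hj
    have hμj := hμ j (by omega)
    have hNj := hN j hj
    rw [totalMean_succ hS]
    refine (div_le_div_of_nonneg_right (sumMoment_succ_le hS hp.le hp1 hq hq1' j)
      (sq_nonneg _)).trans (le_of_eq ?_)
    rw [← hδ]
    field_simp
  · calc p * δ ^ 2 ≤ 1 * 1 := by gcongr; exact pow_le_one₀ hδ0.le hδ1
      _ = 1 := one_mul 1

/-- In the uniform model, few path counts of layer `k + 3` are not positive. -/
theorem unifAvg_nonpos_count_le (hS : ∀ u v : V, u ≠ v → s(u, v) ∈ S) {m : ℕ} (hm : m ≤ S.card)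
    (hm0 : 0 < m) {p q a : ℝ} {k : ℕ} (hpm : p = m / S.card)
    (hq : 0 ≤ q) (hq1 : q < 1 / 2) (hL : LayerSizes lay r k a)
    (hK : 4 * k ≤ a * (p * (1 - 2 * q) ^ 2))
    (hsmall : 3 / (a * (p * (1 - 2 * q) ^ 2)) + 2 * (k + 1) * k / a ≤ 1) :
    unifAvg S m q (fun s => ∑ w ∈ layerSet lay (k + 3),
      if pathVal lay r s (k + 3) w ≤ 0 then 1 else 0) ≤ (layerSet lay (k + 3)).card *
        (8 / (a * (p * (1 - 2 * q) ^ 2)) + 2 * (k + 1) * k / a + 2 * ((k + 3 : ℕ) : ℝ) ^ 2 / m) := by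
  have hS0 : (0 : ℝ) < S.card := by exact_mod_cast hm0.trans_le hm
  have hm0' : (0 : ℝ) < m := by exact_mod_cast hm0
  have hp0 : 0 < p := by rw [hpm]; positivity
  have hp1 : p ≤ 1 := by rw [hpm, div_le_one hS0]; exact_mod_cast hm
  obtain ⟨μ, hμ, hμw⟩ := binAvg_pathVal_concentrated hS hp0 hp1 hq hq1 hL hK hsmall
  set ε := 8 / (a * (p * (1 - 2 * q) ^ 2)) + 2 * (k + 1) * k / a with hε
  rw [unifAvg_sum, ← nsmul_eq_mul, ← Finset.sum_const]
  refine Finset.sum_le_sum fun w hw => ?_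
  obtain ⟨h1, h2⟩ := hμw w (mem_layerSet.1 hw)
  have hfirst := le_unifAvg_poly hq1.le hm hm0 (pathPoly lay r (k + 3) w)
    (totalDegree_pathPoly_le _ _)
  have hsecond := unifAvg_poly_le hq1.le hm hm0 (pathPoly lay r (k + 3) w ^ 2)
  simp only [map_pow, ← hpm] at hfirst hsecond
  change _ * binAvg S p q (fun s => pathVal lay r s (k + 3) w) ≤
    unifAvg S m q (fun s => pathVal lay r s (k + 3) w) at hfirst
  change unifAvg S m q (fun s => pathVal lay r s (k + 3) w ^ 2) ≤
    binAvg S p q (fun s => pathVal lay r s (k + 3) w ^ 2) at hsecond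
  rw [h1] at hfirst
  -- Chebyshev: a count `X ≤ 0` has `(X / μ - 1) ^ 2 ≥ 1`. The square is expanded because the first
  -- and second moments are compared with the binomial model in opposite directions.
  have hcheb : unifAvg S m q (fun s => if pathVal lay r s (k + 3) w ≤ 0 then 1 else 0) ≤
      unifAvg S m q (fun s => (μ ^ 2)⁻¹ * pathVal lay r s (k + 3) w ^ 2 +
        ((-2 * μ⁻¹) * pathVal lay r s (k + 3) w + 1)) := by
    refine unifAvg_mono hq (by linarith) fun s => ?_
    have e : (μ ^ 2)⁻¹ * pathVal lay r s (k + 3) w ^ 2 +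
        ((-2 * μ⁻¹) * pathVal lay r s (k + 3) w + 1) = (pathVal lay r s (k + 3) w / μ - 1) ^ 2 := by
      field_simp; ring
    rw [e]
    split_ifs with h
    · have : pathVal lay r s (k + 3) w / μ ≤ 0 := div_nonpos_of_nonpos_of_nonneg h hμ.le
      nlinarith
    · positivity
  refine hcheb.trans ?_
  rw [unifAvg_add, unifAvg_add, unifAvg_const_mul, unifAvg_const_mul, unifAvg_one hm]
  have hA : (μ ^ 2)⁻¹ * unifAvg S m q (fun s => pathVal lay r s (k + 3) w ^ 2) ≤ 1 + ε := by
    rw [inv_mul_le_iff₀ (by positivity), mul_comm]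
    exact hsecond.trans h2
  have hB : 1 - ((k + 3 : ℕ) : ℝ) ^ 2 / m ≤
      μ⁻¹ * unifAvg S m q (fun s => pathVal lay r s (k + 3) w) := by
    rw [le_inv_mul_iff₀ hμ, mul_comm]
    exact hfirst
  have e : 2 * ((k + 3 : ℕ) : ℝ) ^ 2 / m = 2 * (((k + 3 : ℕ) : ℝ) ^ 2 / m) := by ring
  rw [e]
  linarith

end WeakRecovery

/-! ### Majority votes in the binomial model -/

section Votes

/-- Averaging one after the other over the answers at the pairs `e w`, `w ∈ U`. -/
theorem binAvg_prod {β ι : Type*} [DecidableEq β] [DecidableEq ι] {S : Finset β} {p q : ℝ}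
    {e : ι → β} {U : Finset ι} (heS : ∀ w ∈ U, e w ∈ S) (hinj : Set.InjOn e U)
    {f : ι → (β → ℝ) → ℝ → ℝ} {H : (β → ℝ) → ℝ}
    (hH : ∀ w ∈ U, ∀ s x, H (Function.update s (e w) x) = H s)
    (hf : ∀ w ∈ U, ∀ w' ∈ U, ∀ s x, f w' (Function.update s (e w) x) = f w' s) :
    binAvg S p q (fun s => H s * ∏ w ∈ U, f w s (s (e w))) =
      binAvg S p q (fun s => H s * ∏ w ∈ U,
        ((1 - p) * f w s 0 + (p * (1 - q) * f w s 1 + p * q * f w s (-1)))) := by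
  induction U using Finset.induction_on generalizing H with
  | empty => simp
  | insert w U hw ih =>
    have hne : ∀ w' ∈ U, e w' ≠ e w := fun w' hw' h => hw (by
      rwa [← hinj (Finset.mem_insert_of_mem hw') (Finset.mem_insert_self w U) h])
    have h1 := binAvg_resample (p := p) (q := q) (heS w (Finset.mem_insert_self w U))
      (fun t s => f w s t * (H s * ∏ w' ∈ U, f w' s (s (e w')))) (by
        intro t s x
        rw [hH w (Finset.mem_insert_self w U),
          hf w (Finset.mem_insert_self w U) w (Finset.mem_insert_self w U)]
        congr 2
        refine Finset.prod_congr rfl fun w' hw' => ?_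
        rw [hf w (Finset.mem_insert_self w U) w' (Finset.mem_insert_of_mem hw'),
          Function.update_of_ne (hne w' hw')])
    have h2 := ih (fun w' hw' => heS w' (Finset.mem_insert_of_mem hw'))
      (hinj.mono (by simp)) (H := fun s => H s *
        ((1 - p) * f w s 0 + (p * (1 - q) * f w s 1 + p * q * f w s (-1)))) (by
        intro w' hw' s x
        rw [hH w' (Finset.mem_insert_of_mem hw'),
          hf w' (Finset.mem_insert_of_mem hw') w (Finset.mem_insert_self w U)])
      (fun w₁ h₁ w₂ h₂ => hf w₁ (Finset.mem_insert_of_mem h₁) w₂ (Finset.mem_insert_of_mem h₂))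
    simp only [Finset.prod_insert hw]
    calc _ = _ := by
          congr 1; ext s
          exact (by ring : H s * (f w s (s (e w)) * ∏ w' ∈ U, f w' s (s (e w'))) =
            f w s (s (e w)) * (H s * ∏ w' ∈ U, f w' s (s (e w'))))
      _ = _ := h1
      _ = _ := by congr 1; ext s; ring
      _ = _ := h2
      _ = _ := by congr 1; ext s; ring

/-- The exponential moment of a single vote, with the parameter `(1 - 2 * q) / 4`: a correct label
`y = 1` contributes a factor `exp (-pδ² / 8)` with `δ = 1 - 2 * q`, a wrong one `exp (3pδ² / 8)`. -/
theorem vote_factor_le {p q y : ℝ} (hp : 0 ≤ p) (hq1 : q ≤ 1 / 2) (hq : 0 ≤ q)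
    (hy : y = 1 ∨ y = -1) :
    (1 - p) * Real.exp (-((1 - 2 * q) / 4 * (0 * y))) +
      (p * (1 - q) * Real.exp (-((1 - 2 * q) / 4 * (1 * y))) +
        p * q * Real.exp (-((1 - 2 * q) / 4 * (-1 * y)))) ≤
      Real.exp (p * (1 - 2 * q) ^ 2 * (1 / 8 - y / 4)) := by
  set δ := 1 - 2 * q with hδ
  have hδ0 : 0 ≤ δ := by linarith
  have hδ1 : δ ≤ 1 := by linarith
  have hcosh : Real.cosh (δ / 4) ≤ 1 + δ ^ 2 / 16 := by
    have h1 := Real.cosh_le_exp_half_sq (δ / 4)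
    have h2 : Real.exp ((δ / 4) ^ 2 / 2) ≤ 1 + δ ^ 2 / 16 := by
      have hx : (δ / 4) ^ 2 / 2 ≤ 1 := by nlinarith
      have hx0 : 0 ≤ (δ / 4) ^ 2 / 2 := by positivity
      have h3 := (abs_le.1 (Real.abs_exp_sub_one_sub_id_le (x := (δ / 4) ^ 2 / 2)
        (by rwa [abs_of_nonneg hx0]))).2
      nlinarith
    exact h1.trans h2
  have hsinh : δ / 4 ≤ Real.sinh (δ / 4) := Real.self_le_sinh_iff.2 (by linarith)
  have hsinh' : Real.sinh (δ / 4) ≤ δ / 4 + δ / 16 := by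
    have h3 := (abs_le.1 (Real.abs_exp_sub_one_sub_id_le (x := δ / 4)
      (by rw [abs_of_nonneg] <;> linarith))).2
    have h4 := Real.add_one_le_exp (-(δ / 4))
    rw [Real.sinh_eq]
    nlinarith
  have hexp : ∀ x : ℝ, Real.exp x = Real.cosh x + Real.sinh x := fun x =>
    (Real.cosh_add_sinh x).symm
  have hq' : q = (1 - δ) / 2 := by rw [hδ]; ring
  refine le_trans ?_ (Real.add_one_le_exp _)
  rcases hy with rfl | rfl
  · simp only [mul_zero, neg_zero, Real.exp_zero, mul_one, mul_neg, neg_neg]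
    rw [hexp (δ / 4), hexp (-(δ / 4)), Real.cosh_neg, Real.sinh_neg]
    have e : (1 - p) + (p * (1 - q) * (Real.cosh (δ / 4) + -Real.sinh (δ / 4)) +
        p * q * (Real.cosh (δ / 4) + Real.sinh (δ / 4))) =
        1 + p * (Real.cosh (δ / 4) - 1 - δ * Real.sinh (δ / 4)) := by rw [hq']; ring
    rw [e]
    have : p * (Real.cosh (δ / 4) - 1 - δ * Real.sinh (δ / 4)) ≤ p * (δ ^ 2 / 16 - δ * (δ / 4)) := by
      gcongr; linarith
    nlinarith [mul_nonneg hp (sq_nonneg δ)]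
  · simp only [mul_zero, neg_zero, Real.exp_zero, mul_one, mul_neg, neg_neg]
    rw [hexp (δ / 4), hexp (-(δ / 4)), Real.cosh_neg, Real.sinh_neg]
    have e : (1 - p) + (p * (1 - q) * (Real.cosh (δ / 4) + Real.sinh (δ / 4)) +
        p * q * (Real.cosh (δ / 4) + -Real.sinh (δ / 4))) =
        1 + p * (Real.cosh (δ / 4) - 1 + δ * Real.sinh (δ / 4)) := by rw [hq']; ring
    rw [e]
    have : p * (Real.cosh (δ / 4) - 1 + δ * Real.sinh (δ / 4)) ≤
        p * (δ ^ 2 / 16 + δ * (δ / 4 + δ / 16)) := by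
      gcongr; linarith
    nlinarith

open Classical in
/-- If, on the event `G`, at least seven eighths of the voters `U` have correct labels `y`, and if
`G` and `y` do not depend on the answers between `v` and `U`, then the vote of `U` on `v`
fails only with exponentially small probability. -/
theorem binAvg_vote_le {V : Type*} [DecidableEq V] {S : Finset (Sym2 V)} {p q : ℝ} (hp : 0 ≤ p)
    (hp1 : p ≤ 1) (hq : 0 ≤ q) (hq1 : q ≤ 1 / 2) {v : V} {U : Finset V}
    (hU : ∀ w ∈ U, s(w, v) ∈ S) {G : (Sym2 V → ℝ) → Prop} {y : (Sym2 V → ℝ) → V → ℝ}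
    (hy : ∀ s w, y s w = 1 ∨ y s w = -1)
    (hG : ∀ w ∈ U, ∀ s x, G (Function.update s s(w, v) x) ↔ G s)
    (hyU : ∀ w ∈ U, ∀ w' ∈ U, ∀ s x, y (Function.update s s(w, v) x) w' = y s w')
    (hmaj : ∀ s, G s → 3 / 4 * (U.card : ℝ) ≤ ∑ w ∈ U, y s w) :
    binAvg S p q (fun s => if G s ∧ ∑ w ∈ U, s s(w, v) * y s w ≤ 0 then 1 else 0) ≤
      Real.exp (-(p * (1 - 2 * q) ^ 2 * U.card / 16)) := by
  have hq2 : q ≤ 1 := by linarith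
  set δ := 1 - 2 * q with hδ
  have hδ0 : 0 ≤ δ := by linarith
  have h1 : binAvg S p q (fun s => if G s ∧ ∑ w ∈ U, s s(w, v) * y s w ≤ 0 then 1 else 0) ≤
      binAvg S p q (fun s => (if G s then 1 else 0) *
        ∏ w ∈ U, Real.exp (-(δ / 4 * (s s(w, v) * y s w)))) := by
    refine binAvg_mono hp hp1 hq hq2 fun s => ?_
    rw [← Real.exp_sum, Finset.sum_neg_distrib, ← Finset.mul_sum]
    by_cases hGs : G s
    · simp only [hGs, true_and, if_true, one_mul]
      split_ifs with h
      · refine Real.one_le_exp ?_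
        rw [neg_nonneg]
        exact mul_nonpos_of_nonneg_of_nonpos (by positivity) h
      · exact (Real.exp_pos _).le
    · simp [hGs]
  refine h1.trans ?_
  rw [binAvg_prod (H := fun s => if G s then 1 else 0) (e := fun w => s(w, v))
    (f := fun w s t => Real.exp (-(δ / 4 * (t * y s w)))) hU]
  · have hone := binAvg_const_mul S p q (fun _ => 1) (Real.exp (-(p * δ ^ 2 * U.card / 16)))
    rw [binAvg_one, mul_one] at hone
    rw [← hone]
    refine binAvg_mono hp hp1 hq hq2 fun s => ?_
    by_cases hGs : G s
    · simp only [hGs, if_true]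
      rw [one_mul]
      calc _ ≤ ∏ w ∈ U, Real.exp (p * δ ^ 2 * (1 / 8 - y s w / 4)) := by
            refine Finset.prod_le_prod (fun w _ => ?_) fun w _ => vote_factor_le hp hq1 hq (hy s w)
            have : 0 ≤ 1 - p := by linarith
            have : 0 ≤ 1 - q := by linarith
            positivity
        _ ≤ _ := by
            have e : ∑ w ∈ U, (1 / 8 - y s w / 4) = U.card * (1 / 8) - (∑ w ∈ U, y s w) / 4 := by
              rw [Finset.sum_sub_distrib, Finset.sum_const, nsmul_eq_mul, Finset.sum_div]
            rw [← Real.exp_sum, ← Finset.mul_sum, e]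
            refine Real.exp_le_exp.2 ?_
            have := hmaj s hGs
            have h2 : (U.card : ℝ) * (1 / 8) - (∑ w ∈ U, y s w) / 4 ≤ -(U.card / 16) := by linarith
            calc _ ≤ p * δ ^ 2 * -((U.card : ℝ) / 16) := by gcongr
              _ = _ := by ring
    · simp only [hGs, if_false, zero_mul]
      exact (Real.exp_pos _).le
  · intro w _ w' _ h
    rcases Sym2.eq_iff.1 h with ⟨rfl, -⟩ | ⟨rfl, rfl⟩ <;> rfl
  · intro w hw s x
    simp only [hG w hw s x]
  · intro w hw w' hw' s x
    simp only [hyU w hw w' hw' s x]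

end Votes

/-! ### From the scores to the clusters -/

section Recovery

variable {n : ℕ} [NeZero n]

/-- The sign of an item relative to item `0`: `1` if both are in the same cluster. -/
def relSign (f : Fin n → Bool) (v : Fin n) : ℝ := if f v = f 0 then 1 else -1

/-- The layer of an item, for the number of layers that the algorithm uses on `n` items. -/
def itemLayer (n : ℕ) (v : Fin n) : ℕ := layer n.size v

theorem relSign_mul_self (f : Fin n → Bool) (v : Fin n) : relSign f v * relSign f v = 1 := by
  unfold relSign; split_ifs <;> norm_num

theorem relSign_eq_or (f : Fin n → Bool) (v : Fin n) : relSign f v = 1 ∨ relSign f v = -1 := by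
  unfold relSign; split_ifs <;> simp

theorem initState_mem {n : ℕ} (a : Answers n) (u v : Fin n) :
    (initState n a).mem (v * n + u) = answerCode (a s(v, u)) := by
  have hlt : (v : ℕ) * n + u < n * n := by
    have := v.isLt; have := u.isLt; nlinarith
  have h1 : ((v : ℕ) * n + u) / n = v := by
    rw [mul_comm, Nat.mul_add_div (by have := u.isLt; omega), Nat.div_eq_of_lt u.isLt, add_zero]
  have h2 : ((v : ℕ) * n + u) % n = u := by
    rw [mul_comm, Nat.mul_add_mod, Nat.mod_eq_of_lt u.isLt]
  simp only [initState, dif_pos hlt]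
  congr 2
  simp only [h1, h2]

/-- The sign that the algorithm reads off an answer is the product of the relative signs of the two
items, corrected by the error. -/
theorem codeSign_answers (f : Fin n → Bool) (E X : Finset (Sym2 (Fin n))) (u v : Fin n) :
    ((codeSign ((initState n (answers f E X)).mem (v * n + u)) : ℤ) : ℝ) =
      relSign f v * relSign f u * signs E X s(u, v) := by
  rw [initState_mem, Sym2.eq_swap, answers, signs]
  by_cases hE : s(u, v) ∈ E
  · simp only [hE, if_true, Sym2.lift_mk, relSign]
    by_cases hX : s(u, v) ∈ X <;> cases f u <;> cases f v <;> cases f 0 <;>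
      simp [hX, answerCode, codeSign]
  · simp [hE, answerCode, codeSign]

/-- One round in terms of the answers `signs E X` and scores `relSign f u * z u` of layer `j`. -/
theorem score_succ (f : Fin n → Bool) (E X : Finset (Sym2 (Fin n))) (j : ℕ)
    {z : Fin n → ℝ} (hz : ∀ u : Fin n, itemLayer n u = j → (score n n.size
      (fun i => codeSign ((initState n (answers f E X)).mem i)) j u : ℝ) = relSign f u * z u)
    (v : Fin n) :
    ((score n n.size (fun i => codeSign ((initState n (answers f E X)).mem i)) (j + 1) v : ℤ) : ℝ) =
      if n.size + 1 < j then
        if 0 < relSign f v * ∑ u ∈ layerSet (itemLayer n) j, signs E X s(u, v) * z u then 1 else -1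
      else relSign f v * ∑ u ∈ layerSet (itemLayer n) j, signs E X s(u, v) * z u := by
  have key : ((∑ u ∈ Finset.range n, if layer n.size u = j then
      codeSign ((initState n (answers f E X)).mem (v * n + u)) *
        score n n.size (fun i => codeSign ((initState n (answers f E X)).mem i)) j u else 0 : ℤ) : ℝ)
      = relSign f v * ∑ u ∈ layerSet (itemLayer n) j, signs E X s(u, v) * z u := by
    rw [← Fin.sum_univ_eq_sum_range (fun u => if layer n.size u = j then
      codeSign ((initState n (answers f E X)).mem (v * n + u)) *
        score n n.size (fun i => codeSign ((initState n (answers f E X)).mem i)) j u else 0),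
      layerSet, Finset.sum_filter, Finset.mul_sum]
    push_cast
    refine Finset.sum_congr rfl fun u _ => ?_
    by_cases h : itemLayer n u = j
    · rw [if_pos h, if_pos (show layer n.size u = j from h), codeSign_answers, hz u h]
      linear_combination relSign f v * signs E X s(u, v) * z u * relSign_mul_self f u
    · rw [if_neg h, if_neg (show ¬layer n.size u = j from h), mul_zero]
  rw [← key, score]
  by_cases hj : n.size + 1 < j
  · simp only [hj, if_true, Int.cast_pos]
    split_ifs <;> simp
  · simp only [hj, if_false]

/-- The label that the algorithm gives to an item of layer `k + 3`, relative to the truth. -/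
noncomputable def relLabel (f : Fin n → Bool) (s : Sym2 (Fin n) → ℝ) (w : Fin n) : ℝ :=
  relSign f w *
    if 0 < relSign f w * pathVal (itemLayer n) 0 s (n.size + 3) w then 1 else -1

theorem relLabel_eq_or (f : Fin n → Bool) (s : Sym2 (Fin n) → ℝ) (w : Fin n) :
    relLabel f s w = 1 ∨ relLabel f s w = -1 := by
  unfold relLabel
  rcases relSign_eq_or f w with h | h <;> rw [h] <;> split_ifs <;> norm_num

theorem relLabel_of_pos (f : Fin n → Bool) {s : Sym2 (Fin n) → ℝ} {w : Fin n}
    (h : 0 < pathVal (itemLayer n) 0 s (n.size + 3) w) : relLabel f s w = 1 := by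
  unfold relLabel
  rcases relSign_eq_or f w with h' | h' <;> rw [h']
  · rw [one_mul, one_mul, if_pos h]
  · rw [if_neg (by linarith)]; norm_num

theorem score_eq_pathVal (f : Fin n → Bool) (E X : Finset (Sym2 (Fin n))) {j : ℕ}
    (hj : j ≤ n.size + 2) (v : Fin n) :
    ((score n n.size (fun i => codeSign ((initState n (answers f E X)).mem i)) j v : ℤ) : ℝ) =
      relSign f v * pathVal (itemLayer n) 0 (signs E X) j v := by
  induction j generalizing v with
  | zero =>
    rw [pathVal_zero, score]
    by_cases h : v = 0
    · subst h; simp [relSign]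
    · rw [if_neg h, if_neg (fun h' => h (Fin.ext (by simpa using h')))]; simp
  | succ j ih =>
    rw [score_succ f E X j (fun u _ => ih (by omega) u), if_neg (by omega), pathVal_succ]

/-- If the votes of layer `k + 3`, with the labels it has, are right on layer `k + 4`, and the votes of
layer `k + 4`, with its true labels, are right on all items, then the clusters are recovered. -/
theorem recovers_of_votes (f : Fin n → Bool) {E X : Finset (Sym2 (Fin n))}
    (hE : ∀ v : Fin n, s(v, v) ∉ E)
    (h1 : ∀ v, itemLayer n v = n.size + 4 → 0 < ∑ w ∈ layerSet (itemLayer n) (n.size + 3),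
      signs E X s(w, v) * relLabel f (signs E X) w)
    (h2 : ∀ v, 0 < ∑ w ∈ (layerSet (itemLayer n) (n.size + 4)).erase v, signs E X s(w, v)) :
    Recovers RamProg.cluster (answers f E X) f := by
  obtain ⟨s, t, hs, -, hmem⟩ := reaches_cluster (answers f E X)
  refine ⟨s, t, hs, ?_⟩
  set A : ℕ → ℤ := fun i => codeSign ((initState n (answers f E X)).mem i) with hA
  have e3 : ∀ w : Fin n, ((score n n.size A (n.size + 3) w : ℤ) : ℝ) =
      relSign f w * relLabel f (signs E X) w := by
    intro w
    rw [score_succ f E X (n.size + 2) (fun u _ => score_eq_pathVal f E X le_rfl u),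
      if_pos (by omega), ← pathVal_succ, relLabel, ← mul_assoc, relSign_mul_self, one_mul]
  have e4 : ∀ v : Fin n, itemLayer n v = n.size + 4 →
      ((score n n.size A (n.size + 4) v : ℤ) : ℝ) = relSign f v * 1 := by
    intro v hv
    rw [score_succ f E X (n.size + 3) (fun u _ => e3 u), if_pos (by omega)]
    have := h1 v hv
    rcases relSign_eq_or f v with h | h <;> rw [h]
    · rw [if_pos (by linarith)]; norm_num
    · rw [if_neg (by linarith)]; norm_num
  have e5 : ∀ v : Fin n, ((score n n.size A (n.size + 5) v : ℤ) : ℝ) = relSign f v := by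
    intro v
    rw [score_succ f E X (n.size + 4) e4, if_pos (by omega)]
    -- a pair `s(v, v)` is never queried, so an item of layer `k + 4` has no vote on itself
    have hsum : ∑ u ∈ layerSet (itemLayer n) (n.size + 4), signs E X s(u, v) * 1 =
        ∑ w ∈ (layerSet (itemLayer n) (n.size + 4)).erase v, signs E X s(w, v) := by
      simp only [mul_one]
      rw [Finset.sum_erase]
      rw [signs, if_neg (hE v)]
    rw [hsum]
    have := h2 v
    rcases relSign_eq_or f v with h | h <;> rw [h]
    · rw [if_pos (by linarith)]
    · rw [if_neg (by linarith)]
  have e6 : ∀ v : Fin n, s.mem (n * n + v) = 0 ↔ ¬f v = f 0 := by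
    intro v
    rw [hmem v v.isLt, not_iff_not, ← Int.cast_pos (R := ℝ), e5, relSign]
    split_ifs with h <;> simp [h]
  intro u v
  rw [e6, e6]
  cases f u <;> cases f v <;> cases f 0 <;> simp

end Recovery

/-! ### The sizes of the layers -/

theorem div_le_card_of_progression {n j d b : ℕ} {lay : Fin n → ℕ} (hd : b < d)
    (h : ∀ (t : ℕ) (ht : d * t + b < n), lay ⟨d * t + b, ht⟩ = j) :
    n / d ≤ (layerSet lay j).card := by
  have hlt : ∀ t < n / d, d * t + b < n := by
    intro t ht
    have h1 : d * (t + 1) ≤ d * (n / d) := Nat.mul_le_mul_left d ht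
    have h2 := Nat.mul_div_le n d
    rw [Nat.mul_add] at h1
    omega
  have hinj : Function.Injective fun t : Fin (n / d) => (⟨d * t + b, hlt t t.isLt⟩ : Fin n) := by
    intro t t' htt
    have h1 : d * (t : ℕ) + b = d * (t' : ℕ) + b := by simpa using htt
    exact Fin.ext (Nat.eq_of_mul_eq_mul_left (by omega : 0 < d) (by omega))
  calc n / d = (Finset.univ.image fun t : Fin (n / d) => (⟨d * t + b, hlt t t.isLt⟩ : Fin n)).card :=
        by rw [Finset.card_image_of_injective _ hinj, Finset.card_univ, Fintype.card_fin]
    _ ≤ _ := by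
        refine Finset.card_le_card fun v hv => ?_
        obtain ⟨t, -, rfl⟩ := Finset.mem_image.1 hv
        exact mem_layerSet.2 (h _ _)

theorem div_six_le_card_layer {n c j : ℕ} (hc : c < 6) (hc2 : c ≠ 2)
    (hj : j = if 2 < c then c + n.size - 1 else c) :
    n / 6 ≤ (layerSet (itemLayer n) j).card := by
  refine div_le_card_of_progression hc fun t ht => ?_
  have h1 : (6 * t + c) % 6 = c := by omega
  simp only [itemLayer, layer, h1, if_neg hc2, hj]

theorem div_le_card_layer_mid {n i : ℕ} (hi : i < n.size) :
    n / (6 * n.size) ≤ (layerSet (itemLayer n) (i + 2)).card := by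
  refine div_le_card_of_progression (b := 6 * i + 2) (by omega) fun t ht => ?_
  have h1 : (6 * n.size * t + (6 * i + 2)) % 6 = 2 := by
    rw [mul_assoc]; omega
  have h2 : (6 * n.size * t + (6 * i + 2)) / 6 = n.size * t + i := by
    rw [mul_assoc]; omega
  simp only [itemLayer, layer, h1, h2, Nat.mul_add_mod, Nat.mod_eq_of_lt hi]
  simp

/-- The summand `1` makes up for the item that does not vote on itself. -/
theorem big_layer_card {n c j : ℕ} (hn : 24 ≤ n) (hc : c < 6) (hc2 : c ≠ 2)
    (hj : j = if 2 < c then c + n.size - 1 else c) :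
    (n : ℝ) / 12 + 1 ≤ (layerSet (itemLayer n) j).card := by
  have h1 : (n / 6 : ℕ) ≤ (layerSet (itemLayer n) j).card := div_six_le_card_layer hc hc2 hj
  have h2 : n + 12 ≤ 12 * (n / 6) := by omega
  have h3 : ((n : ℝ) + 12) ≤ 12 * ((n / 6 : ℕ) : ℝ) := by exact_mod_cast h2
  have h4 : ((n / 6 : ℕ) : ℝ) ≤ (layerSet (itemLayer n) j).card := by exact_mod_cast h1
  linarith

theorem layerSizes_itemLayer {n : ℕ} [NeZero n] (hn : 24 ≤ n) (hk : 12 * n.size ≤ n) :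
    LayerSizes (itemLayer n) 0 n.size ((n : ℝ) / 12) where
  root := by simp [itemLayer, layer]
  one_le := Nat.size_pos.2 (by omega)
  pos := by positivity
  le_pow := by
    have h1 : (n : ℝ) ≤ 2 ^ n.size := by exact_mod_cast (Nat.lt_size_self n).le
    have h2 : (2 : ℝ) ^ n.size ≤ 4 ^ n.size := by gcongr; norm_num
    have h3 : (0 : ℝ) ≤ n := Nat.cast_nonneg n
    linarith
  big := by
    rintro j (rfl | rfl)
    · linarith [big_layer_card (c := 1) (j := 1) hn (by norm_num) (by norm_num) (by simp)]
    · linarith [big_layer_card (n := n) (c := 3) (j := n.size + 2) hn (by norm_num) (by norm_num)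
        (by simp; omega)]
  mid := by
    intro j h2 hj
    obtain ⟨i, rfl⟩ : ∃ i, j = i + 2 := ⟨j - 2, by omega⟩
    have h := div_le_card_layer_mid (n := n) (i := i) (by omega)
    have hk0 : 0 < n.size := Nat.size_pos.2 (by omega)
    refine le_trans ?_ (by exact_mod_cast h : ((n / (6 * n.size) : ℕ) : ℝ) ≤ _)
    have h3 : n ≤ 12 * n.size * (n / (6 * n.size)) := by
      have hdm := Nat.div_add_mod n (6 * n.size)
      have hmod : n % (6 * n.size) < 6 * n.size := Nat.mod_lt _ (by omega)
      have e : 12 * n.size * (n / (6 * n.size)) = 2 * (6 * n.size * (n / (6 * n.size))) := by ring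
      omega
    have h3' : (n : ℝ) ≤ 12 * n.size * ((n / (6 * n.size) : ℕ) : ℝ) := by exact_mod_cast h3
    have hk0' : (0 : ℝ) < n.size := by exact_mod_cast hk0
    rw [div_div, div_le_iff₀ (by positivity)]
    linarith

/-! ### The probability of failure -/

/-- The set of pairs of distinct items. -/
abbrev allPairs (n : ℕ) : Finset (Sym2 (Fin n)) := (⊤ : SimpleGraph (Fin n)).edgeFinset

theorem mk_mem_allPairs {n : ℕ} {u v : Fin n} : s(u, v) ∈ allPairs n ↔ u ≠ v := by
  simp [allPairs]

theorem card_allPairs (n : ℕ) : (allPairs n).card = n.choose 2 := by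
  rw [SimpleGraph.card_edgeFinset_top_eq_card_choose_two, Fintype.card_fin]

/-- Three events contain all failures: many path counts of layer `k + 3` have the wrong sign;
this is not so, but the vote of layer `k + 3` is wrong at some item of layer `k + 4`; the vote of
layer `k + 4` with its true labels is wrong at some item. -/
theorem one_sub_recoveryProb_le {n m : ℕ} [NeZero n] (hm : m ≤ n.choose 2) {q : ℝ} (hq : 0 ≤ q)
    (hq1 : q ≤ 1) (f : Fin n → Bool) {W : Finset (Fin n)} (hW0 : 0 < W.card)
    (hW : W = layerSet (itemLayer n) (n.size + 3)) :
    1 - recoveryProb RamProg.cluster n m q f ≤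
      8 / W.card * unifAvg (allPairs n) m q (fun s => ∑ w ∈ W,
        if pathVal (itemLayer n) 0 s (n.size + 3) w ≤ 0 then 1 else 0) +
      (∑ v ∈ layerSet (itemLayer n) (n.size + 4), unifAvg (allPairs n) m q (fun s =>
        if (8 * ∑ w ∈ W, (if pathVal (itemLayer n) 0 s (n.size + 3) w ≤ 0 then (1 : ℝ) else 0)
          ≤ W.card) ∧ ∑ w ∈ W, s s(w, v) * relLabel f s w ≤ 0 then 1 else 0) +
      ∑ v : Fin n, unifAvg (allPairs n) m q (fun s =>
        if ∑ w ∈ (layerSet (itemLayer n) (n.size + 4)).erase v, s s(w, v) ≤ 0 then 1 else 0)) := by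
  classical
  have hW0' : (0 : ℝ) < W.card := by exact_mod_cast hW0
  have hone : unifAvg (allPairs n) m q (fun _ => 1) = 1 :=
    unifAvg_one (by rw [card_allPairs]; exact hm)
  rw [sub_le_iff_le_add, ← unifAvg_const_mul, ← unifAvg_sum, ← unifAvg_sum, ← unifAvg_add,
    ← unifAvg_add]
  refine hone.symm.le.trans ?_
  set B : (Sym2 (Fin n) → ℝ) → ℝ := fun s => 8 / W.card * (∑ w ∈ W,
        if pathVal (itemLayer n) 0 s (n.size + 3) w ≤ 0 then 1 else 0) +
      (∑ v ∈ layerSet (itemLayer n) (n.size + 4),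
        (if (8 * ∑ w ∈ W, (if pathVal (itemLayer n) 0 s (n.size + 3) w ≤ 0 then (1 : ℝ) else 0)
          ≤ W.card) ∧ ∑ w ∈ W, s s(w, v) * relLabel f s w ≤ 0 then 1 else 0) +
      ∑ v : Fin n,
        if ∑ w ∈ (layerSet (itemLayer n) (n.size + 4)).erase v, s s(w, v) ≤ 0 then 1 else 0) with hB
  have h1 : ∀ s : Sym2 (Fin n) → ℝ, 0 ≤ 8 / (W.card : ℝ) * ∑ w ∈ W,
      if pathVal (itemLayer n) 0 s (n.size + 3) w ≤ 0 then (1 : ℝ) else 0 := fun s =>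
    mul_nonneg (by positivity) (Finset.sum_nonneg fun w _ => by split_ifs <;> norm_num)
  have h2 : ∀ (s : Sym2 (Fin n) → ℝ) (v : Fin n), (0 : ℝ) ≤
      if (8 * ∑ w ∈ W, (if pathVal (itemLayer n) 0 s (n.size + 3) w ≤ 0 then (1 : ℝ) else 0)
        ≤ W.card) ∧ ∑ w ∈ W, s s(w, v) * relLabel f s w ≤ 0 then 1 else 0 := fun s v => by
    split_ifs <;> norm_num
  have h3 : ∀ (s : Sym2 (Fin n) → ℝ) (v : Fin n), (0 : ℝ) ≤
      if ∑ w ∈ (layerSet (itemLayer n) (n.size + 4)).erase v, s s(w, v) ≤ 0 then 1 else 0 :=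
    fun s v => by split_ifs <;> norm_num
  have hB0 : ∀ s, 0 ≤ B s := fun s => add_nonneg (h1 s) (add_nonneg
    (Finset.sum_nonneg fun v _ => h2 s v) (Finset.sum_nonneg fun v _ => h3 s v))
  have hfail : ∀ E X : Finset (Sym2 (Fin n)), E ⊆ allPairs n →
      ¬Recovers RamProg.cluster (answers f E X) f → 1 ≤ B (signs E X) := by
    intro E X hE hR
    by_contra hlt
    refine hR (recovers_of_votes f (fun v hv => (mk_mem_allPairs.1 (hE hv)) rfl) ?_ ?_)
    · intro v hv
      rw [← hW]
      by_contra hle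
      rw [not_lt] at hle
      refine hlt ?_
      by_cases hbad : (8 * ∑ w ∈ W, (if pathVal (itemLayer n) 0 (signs E X) (n.size + 3) w ≤ 0
          then (1 : ℝ) else 0)) ≤ W.card
      · refine le_add_of_nonneg_of_le (h1 _) (le_add_of_le_of_nonneg ?_
          (Finset.sum_nonneg fun v _ => h3 _ v))
        refine le_trans ?_ (Finset.single_le_sum (fun v _ => h2 (signs E X) v)
          (mem_layerSet.2 hv))
        rw [if_pos ⟨hbad, hle⟩]
      · refine le_add_of_le_of_nonneg ?_ (add_nonneg (Finset.sum_nonneg fun v _ => h2 _ v)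
          (Finset.sum_nonneg fun v _ => h3 _ v))
        rw [div_mul_eq_mul_div, le_div_iff₀ hW0', one_mul]
        exact (not_le.1 hbad).le
    · intro v
      by_contra hle
      rw [not_lt] at hle
      refine hlt (le_add_of_nonneg_of_le (h1 _) (le_add_of_nonneg_of_le
        (Finset.sum_nonneg fun v _ => h2 _ v) ?_))
      refine le_trans ?_ (Finset.single_le_sum (fun v _ => h3 (signs E X) v) (Finset.mem_univ v))
      rw [if_pos hle]
  rw [recoveryProb, unifAvg, unifAvg]
  -- `recoveryProb` is defined with a classical decidability instance for the edge set
  have hedges : ∀ {inst : Fintype (⊤ : SimpleGraph (Fin n)).edgeSet},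
      @SimpleGraph.edgeFinset _ (⊤ : SimpleGraph (Fin n)) inst = allPairs n := by
    intro inst; ext e; simp [allPairs]
  rw [hedges, ← Finset.sum_add_distrib]
  refine Finset.sum_le_sum fun E hE => ?_
  have hES : E ⊆ allPairs n := (Finset.mem_powersetCard.1 hE).1
  rw [card_allPairs, ← mul_add]
  refine mul_le_mul_of_nonneg_left ?_ (by positivity)
  rw [noiseAvg, noiseAvg, ← Finset.sum_add_distrib]
  refine Finset.sum_le_sum fun X _ => ?_
  rw [← mul_add]
  refine mul_le_mul_of_nonneg_left ?_
    (mul_nonneg (pow_nonneg hq _) (pow_nonneg (by linarith) _))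
  by_cases hR : Recovers RamProg.cluster (answers f E X) f
  · rw [if_pos hR]
    exact le_add_of_nonneg_left (hB0 _)
  · rw [if_neg hR, add_zero]
    exact hfail E X hES hR

theorem recoveryProb_le_one {P : RamProg} {n m : ℕ} (hm : m ≤ n.choose 2) {q : ℝ} (hq : 0 ≤ q)
    (hq1 : q ≤ 1) (f : Fin n → Bool) : recoveryProb P n m q f ≤ 1 := by
  classical
  have hone : unifAvg (allPairs n) m q (fun _ => 1) = 1 :=
    unifAvg_one (by rw [card_allPairs]; exact hm)
  rw [← hone, recoveryProb, unifAvg]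
  have hedges : ∀ {inst : Fintype (⊤ : SimpleGraph (Fin n)).edgeSet},
      @SimpleGraph.edgeFinset _ (⊤ : SimpleGraph (Fin n)) inst = allPairs n := by
    intro inst; ext e; simp [allPairs]
  rw [hedges, card_allPairs]
  refine Finset.sum_le_sum fun E _ => mul_le_mul_of_nonneg_left ?_ (by positivity)
  refine Finset.sum_le_sum fun X _ => mul_le_mul_of_nonneg_left ?_
    (mul_nonneg (pow_nonneg hq _) (pow_nonneg (by linarith) _))
  split_ifs <;> norm_num

/-- The failure probability in terms of the signal strength `K` of `n / 12` items, a lower bound for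
that of a large layer. The first summand belongs to the path counts, the second one to the votes. -/
theorem one_sub_recoveryProb_le_of_signal {n m : ℕ} [NeZero n] (hn : 24 ≤ n)
    (hk : 12 * n.size ≤ n) (hm0 : 0 < m) (hm : m ≤ n.choose 2) {q K : ℝ} (hq : 0 ≤ q)
    (hq1 : q < 1 / 2) (hK : K = (n : ℝ) / 12 * ((m : ℝ) / (n.choose 2 : ℕ) * (1 - 2 * q) ^ 2))
    (hKk : 4 * (n.size : ℝ) ≤ K)
    (hsmall : 3 / K + 2 * ((n.size : ℝ) + 1) * n.size / ((n : ℝ) / 12) ≤ 1) (f : Fin n → Bool) :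
    1 - recoveryProb RamProg.cluster n m q f ≤
      8 * (8 / K + 2 * ((n.size : ℝ) + 1) * n.size / ((n : ℝ) / 12) +
        2 * ((n.size + 3 : ℕ) : ℝ) ^ 2 / m) +
      ((n.choose 2 : ℕ) + 1) * (2 * n * Real.exp (-(K / 16))) := by
  have hq2 : q ≤ 1 := by linarith
  set N := n.choose 2 with hN
  have hcard := card_allPairs n
  rw [← hN] at hcard
  have hN0 : (0 : ℝ) < N := by exact_mod_cast hm0.trans_le hm
  have hp0 : (0 : ℝ) ≤ (m : ℝ) / N := by positivity
  have hp1 : (m : ℝ) / N ≤ 1 := by rw [div_le_one hN0]; exact_mod_cast hm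
  have hS : ∀ u v : Fin n, u ≠ v → s(u, v) ∈ allPairs n := fun u v h => mk_mem_allPairs.2 h
  have hmS : m ≤ (allPairs n).card := by rw [hcard]; exact hm
  set W := layerSet (itemLayer n) (n.size + 3) with hW
  have hWn : (n : ℝ) / 12 + 1 ≤ W.card :=
    big_layer_card (c := 4) hn (by norm_num) (by norm_num) (by simp; omega)
  have hTn : (n : ℝ) / 12 + 1 ≤ (layerSet (itemLayer n) (n.size + 4)).card :=
    big_layer_card (c := 5) hn (by norm_num) (by norm_num) (by simp; omega)
  have hn0 : (0 : ℝ) ≤ n := Nat.cast_nonneg n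
  have hW0' : (0 : ℝ) < W.card := by linarith
  have hW0 : 0 < W.card := by exact_mod_cast hW0'
  refine (one_sub_recoveryProb_le hm hq hq2 f hW0 hW).trans ?_
  have hexp : ∀ U : Finset (Fin n), (n : ℝ) / 12 ≤ U.card →
      Real.exp (-((m : ℝ) / N * (1 - 2 * q) ^ 2 * U.card / 16)) ≤ Real.exp (-(K / 16)) := by
    intro U hU
    refine Real.exp_le_exp.2 (neg_le_neg (div_le_div_of_nonneg_right ?_ (by norm_num)))
    rw [hK, mul_comm]
    exact mul_le_mul_of_nonneg_left hU (mul_nonneg hp0 (sq_nonneg _))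
  refine add_le_add ?_ ?_
  · have h := unifAvg_nonpos_count_le (r := 0) hS hmS hm0 (p := (m : ℝ) / N) (by rw [hcard]) hq hq1
      (layerSizes_itemLayer hn hk) (by rw [← hK]; exact hKk) (by rw [← hK]; exact hsmall)
    rw [← hK, ← hW] at h
    calc _ ≤ 8 / (W.card : ℝ) * (W.card * (8 / K + 2 * ((n.size : ℝ) + 1) * n.size / ((n : ℝ) / 12) +
        2 * ((n.size + 3 : ℕ) : ℝ) ^ 2 / m)) := mul_le_mul_of_nonneg_left h (by positivity)
      _ = _ := by field_simp
  · have hvote1 : ∀ v ∈ layerSet (itemLayer n) (n.size + 4), unifAvg (allPairs n) m q (fun s =>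
        if (8 * ∑ w ∈ W, (if pathVal (itemLayer n) 0 s (n.size + 3) w ≤ 0 then (1 : ℝ) else 0)
          ≤ W.card) ∧ ∑ w ∈ W, s s(w, v) * relLabel f s w ≤ 0 then 1 else 0) ≤
        (N + 1) * Real.exp (-(K / 16)) := by
      intro v hv
      rw [mem_layerSet] at hv
      refine (unifAvg_le_binAvg hq hq2 hmS hm0 fun s => by split_ifs <;> norm_num).trans ?_
      rw [hcard]
      refine mul_le_mul_of_nonneg_left ?_ (by positivity)
      have hup : ∀ w ∈ W, ∀ w' ∈ W, ∀ (s : Sym2 (Fin n) → ℝ) (x : ℝ),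
          pathVal (itemLayer n) 0 (Function.update s s(w, v) x) (n.size + 3) w' =
            pathVal (itemLayer n) 0 s (n.size + 3) w' := fun w hw w' hw' s x =>
        pathVal_update (mem_layerSet.1 hw) hv s x le_rfl (mem_layerSet.1 hw')
      refine le_trans ?_ (hexp W (by linarith))
      convert binAvg_vote_le (S := allPairs n) hp0 hp1 hq hq1.le (v := v) (U := W)
        (fun w hw => hS w v (by rintro rfl; rw [mem_layerSet.1 hw] at hv; omega))
        (G := fun s => 8 * ∑ w ∈ W,
          (if pathVal (itemLayer n) 0 s (n.size + 3) w ≤ 0 then (1 : ℝ) else 0) ≤ W.card)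
        (y := fun s w => relLabel f s w) (fun s w => relLabel_eq_or f s w) ?_ ?_ ?_
      · intro w hw s x
        rw [Finset.sum_congr rfl fun w' hw' => by rw [hup w hw w' hw' s x]]
      · intro w hw w' hw' s x
        simp only [relLabel, hup w hw w' hw' s x]
      · intro s hs
        have h1 : ∀ w ∈ W, (1 : ℝ) - 2 * (if pathVal (itemLayer n) 0 s (n.size + 3) w ≤ 0
            then (1 : ℝ) else 0) ≤ relLabel f s w := by
          intro w _
          split_ifs with h
          · rcases relLabel_eq_or f s w with h' | h' <;> rw [h'] <;> norm_num
          · rw [relLabel_of_pos f (not_le.1 h)]; norm_num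
        have h2 := Finset.sum_le_sum h1
        rw [Finset.sum_sub_distrib, ← Finset.mul_sum, Finset.sum_const, nsmul_eq_mul] at h2
        linarith
    have hvote2 : ∀ v : Fin n, unifAvg (allPairs n) m q (fun s =>
        if ∑ w ∈ (layerSet (itemLayer n) (n.size + 4)).erase v, s s(w, v) ≤ 0 then 1 else 0) ≤
        (N + 1) * Real.exp (-(K / 16)) := by
      intro v
      refine (unifAvg_le_binAvg hq hq2 hmS hm0 fun s => by split_ifs <;> norm_num).trans ?_
      rw [hcard]
      refine mul_le_mul_of_nonneg_left ?_ (by positivity)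
      set U := (layerSet (itemLayer n) (n.size + 4)).erase v with hU
      have hUn : (n : ℝ) / 12 ≤ U.card := by
        have h1 : (layerSet (itemLayer n) (n.size + 4)).card ≤ U.card + 1 := by
          have := Finset.pred_card_le_card_erase (s := layerSet (itemLayer n) (n.size + 4)) (a := v)
          rw [← hU] at this
          omega
        have h2 : ((layerSet (itemLayer n) (n.size + 4)).card : ℝ) ≤ U.card + 1 := by
          exact_mod_cast h1
        linarith
      refine le_trans (le_of_eq ?_) ((binAvg_vote_le (S := allPairs n) hp0 hp1 hq hq1.le (v := v)
        (U := U) (fun w hw => hS w v (Finset.ne_of_mem_erase hw)) (G := fun _ => True)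
        (y := fun _ _ => 1) (fun _ _ => Or.inl rfl) (fun _ _ _ _ => Iff.rfl)
        (fun _ _ _ _ _ _ => rfl) ?_).trans (hexp U hUn))
      · simp only [mul_one, true_and]
      · intro s _
        simp only [Finset.sum_const, nsmul_eq_mul, mul_one]
        have : (0 : ℝ) ≤ U.card := Nat.cast_nonneg _
        linarith
    refine (add_le_add (Finset.sum_le_sum hvote1) (Finset.sum_le_sum fun v _ => hvote2 v)).trans ?_
    rw [Finset.sum_const, Finset.sum_const, nsmul_eq_mul, nsmul_eq_mul, Finset.card_univ,
      Fintype.card_fin]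
    have hTle : ((layerSet (itemLayer n) (n.size + 4)).card : ℝ) ≤ n := by
      have := Finset.card_le_univ (layerSet (itemLayer n) (n.size + 4))
      rw [Fintype.card_fin] at this
      exact_mod_cast this
    have h0 : 0 ≤ ((N : ℝ) + 1) * Real.exp (-(K / 16)) := by positivity
    nlinarith [mul_le_mul_of_nonneg_right hTle h0]

/-! ### Asymptotics -/

theorem size_le_three_mul_log {n : ℕ} (hn : 1 ≤ Real.log n) : (n.size : ℝ) ≤ 3 * Real.log n := by
  have hn0 : 0 < n := by
    rcases Nat.eq_zero_or_pos n with rfl | h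
    · norm_num at hn
    · exact h
  have hs : 0 < n.size := Nat.size_pos.2 hn0
  have h1 : 2 ^ (n.size - 1) ≤ n := Nat.lt_size.1 (by omega)
  have h2 : ((2 : ℝ) ^ (n.size - 1)) ≤ n := by exact_mod_cast h1
  have h3 := Real.log_le_log (by positivity) h2
  rw [Real.log_pow, Nat.cast_sub (by omega)] at h3
  have h4 := Real.log_two_gt_d9
  have h5 : (1 : ℝ) ≤ n.size := by exact_mod_cast hs
  push_cast at h3
  nlinarith

theorem two_le_log_div_log_log {n : ℕ} (hn : 1 < Real.log n) :
    2 ≤ Real.log n / Real.log (Real.log n) := by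
  have h0 : 0 < Real.log (Real.log n) := Real.log_pos hn
  rw [le_div_iff₀ h0]
  have h1 := Real.log_le_sub_one_of_pos (show 0 < Real.log n / 2 by linarith)
  rw [Real.log_div (by linarith) (by norm_num)] at h1
  have h2 := Real.log_two_lt_d9
  linarith

/-- The exponent `log n / log log n` exceeds `2`, and this is all that the analysis uses: the
number of queries is at least `n log n / (2c)^2`. -/
theorem le_queryScale {n : ℕ} {c : ℝ} (hn : 1 < Real.log n) (hc : 0 < c) (hc1 : c < 1 / 2) :
    n * Real.log n / (2 * c) ^ 2 ≤ queryScale n c := by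
  rw [queryScale, div_eq_mul_inv]
  refine mul_le_mul_of_nonneg_left ?_ (mul_nonneg (Nat.cast_nonneg _) (by linarith))
  rw [← Real.rpow_natCast, ← Real.rpow_neg (by linarith)]
  refine Real.rpow_le_rpow_of_exponent_ge (by linarith) (by linarith) ?_
  have := two_le_log_div_log_log hn
  push_cast
  linarith

/-- Rounding up costs at most one query, and the scale is at least `1`. -/
theorem numQueries_bounds {n : ℕ} {c C : ℝ} (hC : 1 ≤ C) (hn : 1 < Real.log n) (hc : 0 < c)
    (hc1 : c < 1 / 2) : C * queryScale n c ≤ numQueries C n c ∧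
      (numQueries C n c : ℝ) ≤ (C + 1) * queryScale n c := by
  have hn1 : (1 : ℝ) ≤ n := by
    rcases Nat.eq_zero_or_pos n with rfl | h
    · norm_num at hn
    · exact_mod_cast h
  have h1 : 1 ≤ queryScale n c := by
    refine le_trans ?_ (le_queryScale hn hc hc1)
    rw [le_div_iff₀ (by positivity)]
    have : (2 * c) ^ 2 ≤ 1 := pow_le_one₀ (by linarith) (by linarith)
    nlinarith
  refine ⟨Nat.le_ceil _, ?_⟩
  have h2 := Nat.ceil_lt_add_one (show 0 ≤ C * queryScale n c by positivity)
  rw [numQueries]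
  linarith

theorem choose_two_le {n : ℕ} : ((n.choose 2 : ℕ) : ℝ) ≤ (n : ℝ) ^ 2 / 2 := by
  rw [Nat.cast_choose_two]
  have : (0 : ℝ) ≤ n := Nat.cast_nonneg n
  nlinarith

/-- An explicit bound for the failure probability. The constant `768 = 6 * 128` gives signal strength
`K ≥ 128 * log n`, since there are `n / 12` items in a large layer and at most `n ^ 2 / 2` pairs. Then
`K ≥ 4 * n.size`, and `exp (-K / 16)` is small enough for the union bound over all votes and for the
loss of the factor `binom(n, 2) + 1`. -/
theorem one_sub_recoveryProb_cluster_le {n : ℕ} {c : ℝ} (hc : 0 < c) (hc1 : c < 1 / 2)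
    (hn : 24 ≤ n) (hlog : 1 < Real.log n) (hlog2 : 1000 * Real.log n ^ 2 ≤ n)
    (hm : numQueries 768 n c ≤ n.choose 2) (f : Fin n → Bool) :
    1 - recoveryProb RamProg.cluster n (numQueries 768 n c) (1 / 2 - c) f ≤
      1 / Real.log n + 3000 * (Real.log n ^ 2 / n) + 2 / n := by
  have : NeZero n := ⟨by omega⟩
  set ℓ := Real.log n with hℓ
  set m := numQueries 768 n c with hmdef
  have hn0 : (24 : ℝ) ≤ n := by exact_mod_cast hn
  have hk3 : (n.size : ℝ) ≤ 3 * ℓ := size_le_three_mul_log hlog.le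
  have hk0 : (0 : ℝ) ≤ n.size := Nat.cast_nonneg _
  have hmlow : 768 * (n * ℓ / (2 * c) ^ 2) ≤ m :=
    (mul_le_mul_of_nonneg_left (le_queryScale hlog hc hc1) (by norm_num)).trans
      (numQueries_bounds (by norm_num) hlog hc hc1).1
  have hc2 : (2 * c) ^ 2 ≤ 1 := pow_le_one₀ (by linarith) (by linarith)
  have hc20 : 0 < (2 * c) ^ 2 := by positivity
  have hmn : (n : ℝ) ≤ m := by
    refine le_trans ?_ hmlow
    rw [← mul_div_assoc, le_div_iff₀ hc20]
    nlinarith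
  have hm0' : (0 : ℝ) < m := by linarith
  have hm0 : 0 < m := by exact_mod_cast hm0'
  have hN0 : (0 : ℝ) < (n.choose 2 : ℕ) := by exact_mod_cast hm0.trans_le hm
  have hN := choose_two_le (n := n)
  set K : ℝ := (n : ℝ) / 12 * ((m : ℝ) / (n.choose 2 : ℕ) * (1 - 2 * (1 / 2 - c)) ^ 2) with hK
  have hKl : 128 * ℓ ≤ K := by
    have e : 1 - 2 * (1 / 2 - c) = 2 * c := by ring
    rw [hK, e]
    have h1 : 768 * (n * ℓ) ≤ m * (2 * c) ^ 2 := by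
      rw [← mul_div_assoc, div_le_iff₀ hc20] at hmlow
      exact hmlow
    have h2 : (m : ℝ) / (n.choose 2 : ℕ) * (2 * c) ^ 2 = m * (2 * c) ^ 2 / (n.choose 2 : ℕ) := by
      ring
    rw [h2]
    calc 128 * ℓ = n / 12 * (768 * (n * ℓ) / ((n : ℝ) ^ 2 / 2)) := by field_simp; norm_num
      _ ≤ n / 12 * (m * (2 * c) ^ 2 / (n.choose 2 : ℕ)) := by gcongr
  have hK0 : 0 < K := by linarith
  have hkk : ((n.size : ℝ) + 1) * n.size ≤ 12 * ℓ ^ 2 := by nlinarith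
  have hterm : 2 * ((n.size : ℝ) + 1) * n.size / ((n : ℝ) / 12) ≤ 288 * (ℓ ^ 2 / n) := by
    rw [div_le_iff₀ (by positivity)]
    have : 288 * (ℓ ^ 2 / n) * ((n : ℝ) / 12) = 24 * ℓ ^ 2 := by field_simp; norm_num
    rw [this]
    linarith
  have hratio : ℓ ^ 2 / n ≤ 1 / 1000 := by
    rw [div_le_iff₀ (by linarith)]; linarith
  have h12 : 12 * n.size ≤ n := by
    have : 12 * (n.size : ℝ) ≤ n := by nlinarith
    exact_mod_cast this
  refine (one_sub_recoveryProb_le_of_signal hn h12 hm0 hm (by linarith) (by linarith) hK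
    (by linarith) ?_ f).trans ?_
  · have : 3 / K ≤ 1 / 2 := by rw [div_le_iff₀ hK0]; linarith
    linarith
  · have t1 : 8 / K ≤ 1 / (16 * ℓ) := by
      rw [div_le_div_iff₀ hK0 (by linarith)]; linarith
    have t2 : 2 * ((n.size + 3 : ℕ) : ℝ) ^ 2 / m ≤ 72 * (ℓ ^ 2 / n) := by
      rw [← mul_div_assoc]
      refine div_le_div₀ (by positivity) ?_ (by linarith) hmn
      push_cast
      have : (n.size : ℝ) + 3 ≤ 6 * ℓ := by linarith
      nlinarith
    have t3 : Real.exp (-(K / 16)) ≤ 1 / (n : ℝ) ^ 4 := by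
      calc Real.exp (-(K / 16)) ≤ Real.exp (-(ℓ * 4)) := Real.exp_le_exp.2 (by linarith)
        _ = 1 / (n : ℝ) ^ 4 := by
            rw [Real.exp_neg, Real.exp_mul, hℓ, Real.exp_log (by linarith), one_div]
            norm_cast
    have t4 : (((n.choose 2 : ℕ) : ℝ) + 1) * (2 * n * Real.exp (-(K / 16))) ≤ 2 / n := by
      calc (((n.choose 2 : ℕ) : ℝ) + 1) * (2 * n * Real.exp (-(K / 16)))
          ≤ (n : ℝ) ^ 2 * (2 * n * (1 / (n : ℝ) ^ 4)) := by
            gcongr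
            nlinarith
        _ = 2 / n := by field_simp
    have t5 : 8 * (1 / (16 * ℓ)) ≤ 1 / ℓ := by
      rw [← mul_div_assoc, div_le_div_iff₀ (by linarith) (by linarith)]; linarith
    have t6 : 0 ≤ ℓ ^ 2 / n := by positivity
    linarith

theorem tendsto_log_natCast : Tendsto (fun n : ℕ => Real.log n) atTop atTop :=
  Real.tendsto_log_atTop.comp tendsto_natCast_atTop_atTop

theorem tendsto_log_sq_div : Tendsto (fun n : ℕ => Real.log n ^ 2 / n) atTop (𝓝 0) := by
  have h := (Real.isLittleO_pow_log_id_atTop (n := 2)).tendsto_div_nhds_zero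
  exact h.comp tendsto_natCast_atTop_atTop

theorem eventually_log_sq_le : ∀ᶠ n : ℕ in atTop, 1000 * Real.log n ^ 2 ≤ n := by
  filter_upwards [tendsto_log_sq_div.eventually_lt_const (show (0 : ℝ) < 1 / 1000 by norm_num),
    eventually_gt_atTop 0] with n hn hn0
  have : (0 : ℝ) < n := by exact_mod_cast hn0
  rw [div_lt_iff₀ this] at hn
  linarith

theorem tendsto_recoveryProb_cluster {c : ℕ → ℝ} (hc : ∀ n, 0 < c n ∧ c n < 1 / 2)
    (hm : ∀ᶠ n : ℕ in atTop, numQueries 768 n (c n) ≤ n.choose 2) (f : (n : ℕ) → Fin n → Bool) :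
    Tendsto (fun n : ℕ => recoveryProb RamProg.cluster n (numQueries 768 n (c n)) (1 / 2 - c n)
      (f n)) atTop (𝓝 1) := by
  have hlim : Tendsto (fun n : ℕ => 1 - (1 / Real.log n + 3000 * (Real.log n ^ 2 / n) + 2 / n))
      atTop (𝓝 1) := by
    have h1 : Tendsto (fun n : ℕ => 1 / Real.log n) atTop (𝓝 0) :=
      tendsto_const_nhds.div_atTop tendsto_log_natCast
    have h2 : Tendsto (fun n : ℕ => (2 : ℝ) / n) atTop (𝓝 0) :=
      tendsto_const_nhds.div_atTop tendsto_natCast_atTop_atTop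
    simpa using tendsto_const_nhds.sub ((h1.add (tendsto_log_sq_div.const_mul 3000)).add h2)
  refine tendsto_of_tendsto_of_tendsto_of_le_of_le' hlim tendsto_const_nhds ?_ ?_
  · filter_upwards [hm, eventually_ge_atTop 24, tendsto_log_natCast.eventually_gt_atTop 1,
      eventually_log_sq_le] with n h1 h2 h3 h4
    have := one_sub_recoveryProb_cluster_le (hc n).1 (hc n).2 h2 h3 h4 h1 (f n)
    linarith
  · filter_upwards [hm] with n h1
    exact recoveryProb_le_one h1 (by linarith [(hc n).2]) (by linarith [(hc n).1]) _

theorem rpow_neg_log_div {n : ℕ} {c : ℝ} (hn : 0 < n) (hc : 0 < c) :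
    (2 * c) ^ (-(Real.log n / Real.log (Real.log n))) =
      (n : ℝ) ^ (Real.log (1 / (2 * c)) / Real.log (Real.log n)) := by
  have hn' : (0 : ℝ) < n := by exact_mod_cast hn
  rw [Real.rpow_def_of_pos (by linarith), Real.rpow_def_of_pos hn', one_div, Real.log_inv]
  congr 1
  ring

theorem queryScale_eq {n : ℕ} {c : ℝ} (hn : 0 < n) (hc : 0 < c) :
    queryScale n c = (n : ℝ) ^ (1 + Real.log (1 / (2 * c)) / Real.log (Real.log n)) *
      Real.log n := by
  have hn' : (0 : ℝ) < n := by exact_mod_cast hn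
  rw [queryScale, rpow_neg_log_div hn hc, Real.rpow_add hn', Real.rpow_one]
  ring

theorem eventually_numQueries_le_choose {c C : ℝ} (hC : 1 ≤ C) (hc : 0 < c) (hc1 : c < 1 / 2) :
    ∀ᶠ n : ℕ in atTop, numQueries C n c ≤ n.choose 2 := by
  have hloglog : Tendsto (fun n : ℕ => Real.log (Real.log n)) atTop atTop :=
    Real.tendsto_log_atTop.comp tendsto_log_natCast
  have hsmall : Tendsto (fun n : ℕ => Real.log (1 / (2 * c)) / Real.log (Real.log n)) atTop (𝓝 0) :=
    tendsto_const_nhds.div_atTop hloglog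
  have hlog : Tendsto (fun n : ℕ => Real.log n / (n : ℝ) ^ (1 / 2 : ℝ)) atTop (𝓝 0) :=
    (isLittleO_log_rpow_atTop (by norm_num : (0 : ℝ) < 1 / 2)).tendsto_div_nhds_zero.comp
      tendsto_natCast_atTop_atTop
  filter_upwards [hsmall.eventually_lt_const (show (0 : ℝ) < 1 / 2 by norm_num),
    hlog.eventually_lt_const (show (0 : ℝ) < 1 / (8 * (C + 1)) by positivity),
    eventually_ge_atTop 4, tendsto_log_natCast.eventually_gt_atTop 1] with n h1 h2 h3 h4
  have hn0 : (0 : ℝ) < n := by exact_mod_cast (by omega : 0 < n)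
  have hn4 : (4 : ℝ) ≤ n := by exact_mod_cast h3
  have hpos : (0 : ℝ) < (n : ℝ) ^ (1 / 2 : ℝ) := Real.rpow_pos_of_pos hn0 _
  rw [div_lt_iff₀ hpos] at h2
  have hQ : queryScale n c ≤ (n : ℝ) ^ 2 / (8 * (C + 1)) := by
    rw [queryScale_eq (by omega) hc, Real.rpow_add hn0, Real.rpow_one]
    have h5 : (n : ℝ) ^ (Real.log (1 / (2 * c)) / Real.log (Real.log n)) ≤ (n : ℝ) ^ (1 / 2 : ℝ) :=
      Real.rpow_le_rpow_of_exponent_le (by linarith) h1.le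
    have h6 : (n : ℝ) ^ (1 / 2 : ℝ) * (n : ℝ) ^ (1 / 2 : ℝ) = n := by
      rw [← Real.rpow_add hn0]; norm_num
    calc _ ≤ n * (n : ℝ) ^ (1 / 2 : ℝ) * (1 / (8 * (C + 1)) * (n : ℝ) ^ (1 / 2 : ℝ)) := by
          gcongr
      _ = n * ((n : ℝ) ^ (1 / 2 : ℝ) * (n : ℝ) ^ (1 / 2 : ℝ)) / (8 * (C + 1)) := by ring
      _ = _ := by rw [h6]; ring
  have hub := (numQueries_bounds hC h4 hc hc1).2
  have hfin : (numQueries C n c : ℝ) ≤ (n.choose 2 : ℕ) := by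
    rw [Nat.cast_choose_two]
    refine hub.trans ?_
    calc (C + 1) * queryScale n c ≤ (C + 1) * ((n : ℝ) ^ 2 / (8 * (C + 1))) := by gcongr
      _ = (n : ℝ) ^ 2 / 8 := by field_simp
      _ ≤ _ := by nlinarith
  exact_mod_cast hfin

theorem numQueries_isBigO {c C : ℝ} (hC : 1 ≤ C) (hc : 0 < c) (hc1 : c < 1 / 2) :
    (fun n : ℕ => (numQueries C n c : ℝ)) =O[atTop] fun n : ℕ =>
      (n : ℝ) ^ (1 + Real.log (1 / (2 * c)) / Real.log (Real.log n)) * Real.log n := by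
  refine IsBigO.of_bound (C + 1) ?_
  filter_upwards [eventually_gt_atTop 0, tendsto_log_natCast.eventually_gt_atTop 1] with n h0 h1
  rw [← queryScale_eq h0 hc, Real.norm_natCast]
  exact (numQueries_bounds hC h1 hc hc1).2.trans
    (mul_le_mul_of_nonneg_left (Real.le_norm_self _) (by linarith))

theorem numQueries_isBigO_of_exp_neg_one_le {c C : ℝ} (hC : 1 ≤ C) (hc : 0 < c) (hc1 : c < 1 / 2)
    (he : Real.exp (-1) ≤ 2 * c) :
    (fun n : ℕ => (numQueries C n c : ℝ)) =O[atTop] fun n : ℕ =>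
      (n : ℝ) ^ (1 + 1 / Real.log (Real.log n)) * Real.log n := by
  refine (numQueries_isBigO hC hc hc1).trans (IsBigO.of_bound 1 ?_)
  filter_upwards [eventually_gt_atTop 0, tendsto_log_natCast.eventually_gt_atTop 1] with n h0 h1
  have hn1 : (1 : ℝ) ≤ n := by exact_mod_cast h0
  have h2 : Real.log (1 / (2 * c)) ≤ 1 := by
    rw [one_div, Real.log_inv, neg_le, Real.le_log_iff_exp_le (by linarith)]
    exact he
  have h3 := Real.log_pos h1
  have hpow : ∀ x : ℝ, 0 ≤ (n : ℝ) ^ x := fun x => Real.rpow_nonneg (Nat.cast_nonneg n) x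
  rw [one_mul, norm_mul, norm_mul, Real.norm_of_nonneg (hpow _), Real.norm_of_nonneg (hpow _)]
  refine mul_le_mul_of_nonneg_right ?_ (norm_nonneg _)
  refine Real.rpow_le_rpow_of_exponent_le hn1 ?_
  gcongr

theorem theorem1 :
    ∃ (P : RamProg) (p : Polynomial ℕ) (C : ℝ), 0 < C ∧
      -- polynomial running time, on all inputs
      (∀ (n : ℕ) (a : Answers n), ∃ (s : RamState) (t : ℕ),
        RamExec P (initState n a) s t ∧ t ≤ p.eval n) ∧
      -- the number of queries, with constants that do not depend on the gap
      (∃ A B : ℝ, 0 < A ∧ 0 < B ∧ ∀ᶠ n : ℕ in atTop, ∀ c : ℝ, 0 < c → c < 1 / 2 →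
        A * queryScale n c ≤ (numQueries C n c : ℝ) ∧
        (numQueries C n c : ℝ) ≤ B * queryScale n c) ∧
      -- recovery with high probability; the gap and the clusters may vary with `n`
      (∀ c : ℕ → ℝ, (∀ n, 0 < c n ∧ c n < 1 / 2) →
        (∀ᶠ n : ℕ in atTop, numQueries C n (c n) ≤ n.choose 2) →
        ∀ f : (n : ℕ) → Fin n → Bool,
          Tendsto (fun n : ℕ => recoveryProb P n (numQueries C n (c n)) (1 / 2 - c n) (f n))
            atTop (𝓝 1)) ∧
      -- constant gaps
      (∀ c : ℝ, 0 < c → c < 1 / 2 →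
        (∀ᶠ n : ℕ in atTop, numQueries C n c ≤ n.choose 2) ∧
        ((fun n : ℕ => (numQueries C n c : ℝ)) =O[atTop] fun n : ℕ =>
          (n : ℝ) ^ (1 + Real.log (1 / (2 * c)) / Real.log (Real.log n)) * Real.log n) ∧
        (Real.exp (-1) ≤ 2 * c →
          (fun n : ℕ => (numQueries C n c : ℝ)) =O[atTop] fun n : ℕ =>
            (n : ℝ) ^ (1 + 1 / Real.log (Real.log n)) * Real.log n)) := by
  refine ⟨RamProg.cluster, Polynomial.C 1000 * (Polynomial.X + Polynomial.C 10) ^ 3, 768,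
    by norm_num, fun n a => ?_, ⟨768, 768 + 1, by norm_num, by norm_num, ?_⟩,
    fun c hc hm f => tendsto_recoveryProb_cluster hc hm f, fun c hc hc1 =>
    ⟨eventually_numQueries_le_choose (by norm_num) hc hc1,
      numQueries_isBigO (by norm_num) hc hc1,
      numQueries_isBigO_of_exp_neg_one_le (by norm_num) hc hc1⟩⟩
  · obtain ⟨s, t, hs, ht, -⟩ := reaches_cluster a
    exact ⟨s, t, hs, by simpa using ht⟩
  · filter_upwards [tendsto_log_natCast.eventually_gt_atTop 1] with n hn c hc hc1
    exact numQueries_bounds (by norm_num) hn hc hc1
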